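/- **Definitions.** A relation algebra is an algebra $\mathfrak A=(A,+,-,;,{}^\smile,1')$ such that $(A,+,-)$ is a Boolean algebra and, for all $r,s,t\in A$: $r;(s;t)=(r;s);t$, $r;1'=r$, $r^{\smile\smile}=r$, $(r;s)^\smile=s^\smile;r^\smile$, $(r+s);t=r;t+s;t$, $(r+s)^\smile=r^\smile+s^\smile$, and $r^\smile;-(r;s)+(-s)=-s$. An element $f$ is *functional* if $f^\smile;f\le 1'$. An atom $x\le 1'$ is *measurable* if $x;1;x$ is the sum (supremum) of the non-zero functional elements below it; these elements then form a group $G_x$ under $;$ and ${}^\smile$ with identity element $x$. The algebra $\mathfrak A$ is *measurable* if $1'$ is the sum of the measurable atoms. A *completion* of $\mathfrak A$ is a complete relation algebra $\mathfrak B$ that has $\mathfrak A$ as a subalgebra and in which every element is the sum of the elements of $\mathfrak A$ below it. It is unique up to isomorphism over $\mathfrak A$. The algebra $\mathfrak A$ is *essentially isomorphic* to $\mathfrak C$ if its completion is isomorphic to $\mathfrak C$. A *set relation algebra* on a set $U$ is a collection of binary relations on $U$ that has a largest element, contains the identity relation on $U$, and is closed under union, complement in the largest element, relational composition and relational inverse,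 with these as its operations. The algebra $\mathfrak A$ is *completely representable* if there is an isomorphism of $\mathfrak A$ onto some set relation algebra that takes every existing supremum in $\mathfrak A$ to the union of the images. *Cyclic group relation algebras.* Let $E$ be an equivalence relation on a set $I$, let $n_x$ $(x\in I)$ be positive integers, and let $m_{xy}$ $((x,y)\in E)$ be positive integers such that, for all $(x,y),(y,z)\in E$, 1. $m_{xy}$ divides $n_x$ and $n_y$; 2. $m_{xx}=n_x$; 3. $m_{yx}=m_{xy}$; 4. $\gcd(m_{xy},m_{yz})=\gcd(m_{xy},m_{xz})=\gcd(m_{xz},m_{yz})$. Let $G_x$ $(x\in I)$ be pairwise disjoint copies of $\mathbb Z/n_x\mathbb Z$, let $H_{xy}\le G_x$ and $K_{xy}\le G_y$ be the subgroups of the multiples of $m_{xy}$, and let $\varphi_{xy}\colon G_x/H_{xy}\to G_y/K_{xy}$ be the isomorphism $H_{xy}+\ell\mapsto K_{xy}+\ell$. For $(x,y)\in E$ and a coset $\alpha$ of $H_{xy}$ put $$R_{xy,\alpha}=\bigcup_{\gamma\in G_x/H_{xy}}\gamma\times\varphi_{xy}(\gamma+\alpha).$$ The set of all unions of relations $R_{xy,\alpha}$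 is the universe of a set relation algebra on $\bigcup_{x\in I}G_x$, called the *cyclic group relation algebra* determined by $(E,n,m)$. **Theorem (Representation Theorem).** Let $\mathfrak A$ be a measurable relation algebra such that, for each measurable atom $x$, the group $G_x$ is finite and cyclic. Then $\mathfrak A$ is essentially isomorphic to a cyclic group relation algebra determined by some system $(E,n,m)$ as above. Moreover, $\mathfrak A$ is completely representable. -/

import Mathlib

universe u v w

namespace RelAlg

/-- A relation algebra in the sense of Tarski: a Boolean algebra with relative multiplication
`comp`, converse `conv` and an identity element `ident`, subject to Tarski's axioms. -/
class RelationAlgebra (A : Type u) extends BooleanAlgebra A where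
  comp : A → A → A
  conv : A → A
  ident : A
  comp_assoc : ∀ r s t : A, comp r (comp s t) = comp (comp r s) t
  comp_ident : ∀ r : A, comp r ident = r
  conv_conv : ∀ r : A, conv (conv r) = r
  conv_comp : ∀ r s : A, conv (comp r s) = comp (conv s) (conv r)
  sup_comp : ∀ r s t : A, comp (r ⊔ s) t = comp r t ⊔ comp s t
  conv_sup : ∀ r s : A, conv (r ⊔ s) = conv r ⊔ conv s
  tarski : ∀ r s : A, comp (conv r) (comp r s)ᶜ ⊔ sᶜ = sᶜ

namespace RelationAlgebra

variable {A : Type u} [RelationAlgebra A]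

/-! ### Elementary arithmetic -/

theorem le_tarski (r s : A) : comp (conv r) (comp r s)ᶜ ≤ sᶜ := by
  have h := tarski r s
  exact sup_eq_right.mp h

theorem conv_mono {a b : A} (h : a ≤ b) : conv a ≤ conv b := by
  have h1 := conv_sup a b
  rw [sup_eq_right.mpr h] at h1
  rw [h1]
  exact le_sup_left

theorem comp_mono_left {a b : A} (c : A) (h : a ≤ b) : comp a c ≤ comp b c := by
  have h1 := sup_comp a b c
  rw [sup_eq_right.mpr h] at h1
  rw [h1]
  exact le_sup_left

theorem comp_sup (r s t : A) : comp r (s ⊔ t) = comp r s ⊔ comp r t := by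
  rw [← conv_conv (comp r (s ⊔ t)), conv_comp, conv_sup, sup_comp, conv_sup, conv_comp,
    conv_comp, conv_conv, conv_conv, conv_conv]

theorem comp_mono_right {a b : A} (c : A) (h : a ≤ b) : comp c a ≤ comp c b := by
  have h1 := comp_sup c a b
  rw [sup_eq_right.mpr h] at h1
  rw [h1]
  exact le_sup_left

theorem comp_mono {a b c d : A} (h : a ≤ b) (h' : c ≤ d) : comp a c ≤ comp b d :=
  (comp_mono_left c h).trans (comp_mono_right b h')

theorem conv_ident : conv (ident : A) = ident := by
  have h := conv_comp (conv (ident : A)) ident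
  rw [comp_ident, conv_conv, comp_ident] at h
  exact h.symm

theorem ident_comp (r : A) : comp ident r = r := by
  rw [← conv_conv (comp ident r), conv_comp, conv_ident, comp_ident, conv_conv]

theorem cycle {a b c : A} (h : comp a b ≤ cᶜ) : comp (conv a) c ≤ bᶜ :=
  (comp_mono_right _ (le_compl_comm.mp h)).trans (le_tarski a b)

/-- The modular law. -/
theorem modular (a b c : A) : comp a b ⊓ c ≤ comp a (b ⊓ comp (conv a) c) := by
  have h2 : comp a (b ⊓ (comp (conv a) c)ᶜ) ≤ cᶜ := by
    have h := cycle (a := conv a) (b := c) (c := (comp (conv a) c)ᶜ) (by rw [compl_compl])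
    rw [conv_conv] at h
    exact (comp_mono_right _ inf_le_right).trans h
  have h3 : comp a b = comp a (b ⊓ comp (conv a) c) ⊔ comp a (b ⊓ (comp (conv a) c)ᶜ) := by
    rw [← comp_sup, ← inf_sup_left, sup_compl_eq_top, inf_top_eq]
  rw [h3, inf_sup_right]
  refine sup_le inf_le_left ?_
  exact (inf_le_inf_right c h2).trans (by rw [compl_inf_eq_bot]; exact bot_le)

theorem le_comp_conv_comp (a : A) : a ≤ comp a (comp (conv a) a) := by
  have h := modular a ident a
  rw [comp_ident, inf_idem] at h
  exact h.trans (comp_mono_right _ inf_le_right)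

theorem conv_bot : conv (⊥ : A) = ⊥ := by
  have h := conv_mono (bot_le : (⊥ : A) ≤ conv ⊥)
  rw [conv_conv] at h
  exact le_bot_iff.mp h

theorem comp_bot (a : A) : comp a ⊥ = ⊥ := by
  have h := cycle (a := conv a) (b := ⊤) (c := ⊥) (by rw [compl_bot]; exact le_top)
  rw [conv_conv, compl_top] at h
  exact le_bot_iff.mp h

theorem conv_eq_self {x : A} (hx : x ≤ ident) : conv x = x := by
  have key : ∀ y : A, y ≤ ident → y ≤ conv y := by
    intro y hy
    calc y ≤ comp y (comp (conv y) y) := le_comp_conv_comp y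
      _ ≤ comp ident (comp (conv y) ident) := comp_mono hy (comp_mono_right _ hy)
      _ = conv y := by rw [ident_comp, comp_ident]
  apply le_antisymm _ (key x hx)
  have h := key (conv x) (by rw [← conv_ident]; exact conv_mono hx)
  rwa [conv_conv] at h

theorem comp_self {x : A} (hx : x ≤ ident) : comp x x = x := by
  apply le_antisymm
  · exact (comp_mono_right _ hx).trans (comp_ident x).le
  · calc x ≤ comp x (comp (conv x) x) := le_comp_conv_comp x
      _ ≤ comp x (comp ident x) := comp_mono_right _
          (comp_mono_left _ (by rw [conv_eq_self hx]; exact hx))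
      _ = comp x x := by rw [ident_comp]

/-! ### Measurable relation algebras -/

/-- The square `x;1;x`. -/
def square (x : A) : A := comp (comp x ⊤) x

/-- `f` is functional if `f˘;f ≤ 1'`. -/
def IsFunctional (f : A) : Prop := comp (conv f) f ≤ ident

/-- The set of nonzero functional elements below `x;1;x`. -/
def functionsBelow (x : A) : Set A := {f | f ≠ ⊥ ∧ f ≤ square x ∧ IsFunctional f}

/-- A subidentity atom is measurable if its square is a sum of functional elements. -/
structure IsMeasurableAtom (x : A) : Prop where
  isAtom : IsAtom x
  le_ident : x ≤ ident
  isLUB : IsLUB (functionsBelow x) (square x)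

variable (A) in
/-- A relation algebra is measurable if its identity element is the sum of measurable atoms. -/
def IsMeasurable : Prop := IsLUB {x : A | IsMeasurableAtom x} ident

theorem comp_of_le_square {x f : A} (hx : x ≤ ident) (hf : f ≤ square x) : comp x f = f := by
  apply le_antisymm
  · exact (comp_mono_left _ hx).trans (ident_comp f).le
  · have h := modular x (comp ⊤ x) f
    rw [square] at hf
    rw [comp_assoc, inf_eq_right.mpr hf, conv_eq_self hx] at h
    refine h.trans ((comp_mono_right _ inf_le_right).trans ?_)
    rw [comp_assoc, comp_self hx]

theorem conv_square {x : A} (hx : x ≤ ident) : conv (square x) = square x := by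
  have htop : conv (⊤ : A) = ⊤ := by
    apply le_antisymm le_top
    have h := conv_mono (le_top : conv (⊤ : A) ≤ ⊤)
    rwa [conv_conv] at h
  rw [square, conv_comp, conv_comp, conv_eq_self hx, htop, comp_assoc]

theorem conv_le_square {x f : A} (hx : x ≤ ident) (hf : f ≤ square x) : conv f ≤ square x := by
  have h := conv_mono hf
  rwa [conv_square hx] at h

theorem comp_of_le_square' {x f : A} (hx : x ≤ ident) (hf : f ≤ square x) : comp f x = f := by
  have h := congrArg conv (comp_of_le_square hx (conv_le_square hx hf))
  rwa [conv_comp, conv_conv, conv_eq_self hx] at h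

theorem comp_le_square {x f g : A} (hf : f ≤ square x) (hg : g ≤ square x) :
    comp f g ≤ square x := by
  refine (comp_mono hf hg).trans ?_
  have h : comp (comp (comp x ⊤) x) (comp (comp x ⊤) x)
      = comp (comp x (comp ⊤ (comp (comp x x) ⊤))) x := by
    simp only [comp_assoc]
  rw [square, h]
  exact comp_mono_left _ (comp_mono_right _ le_top)

theorem conv_comp_self_eq {x f : A} (hx : IsAtom x) (hx1 : x ≤ ident)
    (hf : f ∈ functionsBelow x) : comp (conv f) f = x := by
  obtain ⟨h0, hs, hfun⟩ := hf
  have hle : comp (conv f) f ≤ x := by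
    have h1 : comp (comp (comp x (conv f)) f) x = comp (conv f) f := by
      rw [comp_of_le_square hx1 (conv_le_square hx1 hs), ← comp_assoc,
        comp_of_le_square' hx1 hs]
    rw [← h1]
    calc comp (comp (comp x (conv f)) f) x = comp (comp x (comp (conv f) f)) x := by
          rw [comp_assoc]
      _ ≤ comp (comp x ident) x := comp_mono_left _ (comp_mono_right _ hfun)
      _ = x := by rw [comp_ident, comp_self hx1]
  rcases hx.le_iff.mp hle with h | h
  · exfalso
    apply h0
    have h2 := le_comp_conv_comp f
    rw [h, comp_bot] at h2
    exact le_bot_iff.mp h2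
  · exact h

theorem self_mem_functionsBelow {x : A} (hx : IsAtom x) (hx1 : x ≤ ident) :
    x ∈ functionsBelow x := by
  refine ⟨hx.1, ?_, ?_⟩
  · calc x = comp (comp x x) x := by rw [comp_self hx1, comp_self hx1]
      _ ≤ square x := comp_mono_left _ (comp_mono_right _ le_top)
  · rw [IsFunctional, conv_eq_self hx1, comp_self hx1]
    exact hx1

theorem comp_mem_functionsBelow {x f g : A} (hx : IsAtom x) (hx1 : x ≤ ident)
    (hf : f ∈ functionsBelow x) (hg : g ∈ functionsBelow x) : comp f g ∈ functionsBelow x := by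
  have e : comp (conv (comp f g)) (comp f g) = x := by
    calc comp (conv (comp f g)) (comp f g) = comp (conv g) (comp (comp (conv f) f) g) := by
          rw [conv_comp]; simp only [comp_assoc]
      _ = x := by
          rw [conv_comp_self_eq hx hx1 hf, comp_of_le_square hx1 hg.2.1,
            conv_comp_self_eq hx hx1 hg]
  refine ⟨?_, comp_le_square hf.2.1 hg.2.1, ?_⟩
  · intro h
    rw [h, comp_bot] at e
    exact hx.1 e.symm
  · rw [IsFunctional, e]
    exact hx1

theorem conv_mem_functionsBelow {x f : A} (hx : IsMeasurableAtom x)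
    (hf : f ∈ functionsBelow x) : conv f ∈ functionsBelow x := by
  have hx1 := hx.le_ident
  have hc0 : conv f ≠ ⊥ := by
    intro h
    apply hf.1
    rw [← conv_conv f, h, conv_bot]
  have hcs := conv_le_square hx1 hf.2.1
  obtain ⟨g, hg, hgf⟩ : ∃ g ∈ functionsBelow x, conv f ⊓ g ≠ ⊥ := by
    by_contra hcon
    push Not at hcon
    have h1 : square x ≤ (conv f)ᶜ := by
      refine hx.isLUB.2 ?_
      intro g hg
      exact le_compl_iff_disjoint_left.mpr (disjoint_iff.mpr (hcon g hg))
    exact hc0 (le_bot_iff.mp (by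
      have := le_inf le_rfl (hcs.trans h1)
      rwa [inf_compl_eq_bot] at this))
  set h := conv f ⊓ g with hh
  have hle : h ≤ conv f := inf_le_left
  have hhm : h ∈ functionsBelow x := by
    refine ⟨hgf, hle.trans hcs, ?_⟩
    exact (comp_mono (conv_mono inf_le_right) inf_le_right).trans hg.2.2
  have h1 : f ≤ conv h := by
    calc f = comp x f := (comp_of_le_square hx1 hf.2.1).symm
      _ = comp (comp (conv h) h) f := by rw [conv_comp_self_eq hx.isAtom hx1 hhm]
      _ = comp (conv h) (comp h f) := by rw [comp_assoc]
      _ ≤ comp (conv h) (comp (conv f) f) := comp_mono_right _ (comp_mono_left _ hle)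
      _ = comp (conv h) x := by rw [conv_comp_self_eq hx.isAtom hx1 hf]
      _ = conv h := comp_of_le_square' hx1 (conv_le_square hx1 hhm.2.1)
  have h2 : conv f ≤ h := by
    have := conv_mono h1
    rwa [conv_conv] at this
  have h3 : conv f = h := le_antisymm h2 hle
  rw [h3]
  exact hhm

/-- The set `G_x` of nonzero functional elements below `x;1;x`, for a measurable atom `x`. -/
def AtomGroup (x : {x : A // IsMeasurableAtom x}) : Type u := {f : A // f ∈ functionsBelow x.1}

/-- `G_x` is a group under relative multiplication and converse, with identity element `x`. -/
instance (x : {x : A // IsMeasurableAtom x}) : Group (AtomGroup x) where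
  mul f g := ⟨comp f.1 g.1, comp_mem_functionsBelow x.2.isAtom x.2.le_ident f.2 g.2⟩
  one := ⟨x.1, self_mem_functionsBelow x.2.isAtom x.2.le_ident⟩
  inv f := ⟨conv f.1, conv_mem_functionsBelow x.2 f.2⟩
  mul_assoc f g h := Subtype.ext (comp_assoc f.1 g.1 h.1).symm
  one_mul f := Subtype.ext (comp_of_le_square x.2.le_ident f.2.2.1)
  mul_one f := Subtype.ext (comp_of_le_square' x.2.le_ident f.2.2.1)
  inv_mul_cancel f := Subtype.ext (conv_comp_self_eq x.2.isAtom x.2.le_ident f.2)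

/-! ### Embeddings and completions -/

/-- A relation algebra embedding. -/
structure IsEmbedding {B : Type v} [RelationAlgebra B] (e : A → B) : Prop where
  injective : Function.Injective e
  map_sup : ∀ a b, e (a ⊔ b) = e a ⊔ e b
  map_compl : ∀ a, e aᶜ = (e a)ᶜ
  map_comp : ∀ a b, e (comp a b) = comp (e a) (e b)
  map_conv : ∀ a, e (conv a) = conv (e a)
  map_ident : e ident = ident

/-- A relation algebra isomorphism. -/
structure IsIsomorphism {B : Type v} [RelationAlgebra B] (e : A → B) : Prop
    extends IsEmbedding e where
  surjective : Function.Surjective e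

/-- `e : A → B` exhibits `B` as the completion (minimal complete extension) of `A`: `B` is
complete, `e` is an embedding, and every element of `B` is the sum of the elements of (the image
of) `A` below it. -/
structure IsCompletion {B : Type v} [RelationAlgebra B] (e : A → B) : Prop
    extends IsEmbedding e where
  complete : ∀ S : Set B, ∃ b, IsLUB S b
  dense : ∀ b : B, IsLUB {c | c ∈ Set.range e ∧ c ≤ b} b

/-- `A` is essentially isomorphic to `C` if the completion of `A` is isomorphic to `C`. -/
def EssentiallyIsomorphic (A : Type u) (C : Type u) [RelationAlgebra A] [RelationAlgebra C] :
    Prop :=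
  ∃ (B : Type u) (_ : RelationAlgebra B),
    (∃ e : A → B, IsCompletion e) ∧ ∃ i : B → C, IsIsomorphism i

end RelationAlgebra

/-! ### Set relation algebras -/

/-- A set relation algebra on a base set `U`: a collection of binary relations on `U` with a
largest element (the unit), closed under union, complement in the unit, relational composition
and relational inverse, and containing the identity relation on `U`. -/
structure SetRelationAlgebra (U : Type u) where
  carrier : Set (SetRel U U)
  unit : SetRel U U
  unit_mem : unit ∈ carrier
  subset_unit : ∀ R ∈ carrier, R ⊆ unit
  union_mem : ∀ R ∈ carrier, ∀ S ∈ carrier, R ∪ S ∈ carrier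
  compl_mem : ∀ R ∈ carrier, unit \ R ∈ carrier
  comp_mem : ∀ R ∈ carrier, ∀ S ∈ carrier, R.comp S ∈ carrier
  inv_mem : ∀ R ∈ carrier, R.inv ∈ carrier
  id_mem : (SetRel.id : SetRel U U) ∈ carrier

namespace SetRelationAlgebra

variable {U : Type u} (S : SetRelationAlgebra U)

/-- The elements of a set relation algebra. -/
def Elem : Type u := {R : SetRel U U // R ∈ S.carrier}

theorem empty_mem : (∅ : SetRel U U) ∈ S.carrier := by
  have h := S.compl_mem _ S.unit_mem
  rwa [Set.sdiff_self] at h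

theorem inter_mem {R T : SetRel U U} (hR : R ∈ S.carrier) (hT : T ∈ S.carrier) :
    R ∩ T ∈ S.carrier := by
  have h := S.compl_mem _ (S.union_mem _ (S.compl_mem _ hR) _ (S.compl_mem _ hT))
  have e : S.unit \ (S.unit \ R ∪ S.unit \ T) = R ∩ T := by
    ext p
    have : p ∈ R → p ∈ S.unit := fun h => S.subset_unit R hR h
    simp only [Set.mem_sdiff, Set.mem_union, Set.mem_inter_iff]
    tauto
  rwa [e] at h

theorem unit_inv {u v : U} (h : (u, v) ∈ S.unit) : (v, u) ∈ S.unit :=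
  S.subset_unit _ (S.inv_mem _ S.unit_mem) h

theorem unit_comp {u v w : U} (h : (u, v) ∈ S.unit) (h' : (v, w) ∈ S.unit) : (u, w) ∈ S.unit :=
  S.subset_unit _ (S.comp_mem _ S.unit_mem _ S.unit_mem) ⟨v, h, h'⟩

/-- The relation algebra operations of a set relation algebra are the set-theoretic ones. -/
instance : RelationAlgebra S.Elem where
  le R T := R.1 ⊆ T.1
  lt R T := R.1 ⊆ T.1 ∧ ¬ T.1 ⊆ R.1
  le_refl R := subset_refl R.1
  le_trans R T V h h' := subset_trans h h'
  lt_iff_le_not_ge R T := Iff.rfl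
  le_antisymm R T h h' := Subtype.ext (Set.Subset.antisymm h h')
  sup R T := ⟨R.1 ∪ T.1, S.union_mem _ R.2 _ T.2⟩
  le_sup_left R T := Set.subset_union_left
  le_sup_right R T := Set.subset_union_right
  sup_le R T V h h' := Set.union_subset h h'
  inf R T := ⟨R.1 ∩ T.1, S.inter_mem R.2 T.2⟩
  inf_le_left R T := Set.inter_subset_left
  inf_le_right R T := Set.inter_subset_right
  le_inf R T V h h' := Set.subset_inter h h'
  le_sup_inf R T V := (Set.union_inter_distrib_left R.1 T.1 V.1).symm.subset
  compl R := ⟨S.unit \ R.1, S.compl_mem _ R.2⟩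
  top := ⟨S.unit, S.unit_mem⟩
  bot := ⟨∅, S.empty_mem⟩
  inf_compl_le_bot R := fun _ h => h.2.2 h.1
  top_le_sup_compl R := fun p hp => (Classical.em (p ∈ R.1)).imp id fun h => ⟨hp, h⟩
  le_top R := S.subset_unit _ R.2
  bot_le R := Set.empty_subset _
  comp R T := ⟨R.1.comp T.1, S.comp_mem _ R.2 _ T.2⟩
  conv R := ⟨R.1.inv, S.inv_mem _ R.2⟩
  ident := ⟨SetRel.id, S.id_mem⟩
  comp_assoc R T V := Subtype.ext (SetRel.comp_assoc R.1 T.1 V.1).symm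
  comp_ident R := Subtype.ext (SetRel.comp_id R.1)
  conv_conv R := rfl
  conv_comp R T := Subtype.ext (SetRel.inv_comp R.1 T.1)
  sup_comp R T V := Subtype.ext (by
    ext p
    constructor
    · rintro ⟨b, h | h, h'⟩
      exacts [Or.inl ⟨b, h, h'⟩, Or.inr ⟨b, h, h'⟩]
    · rintro (⟨b, h, h'⟩ | ⟨b, h, h'⟩)
      exacts [⟨b, Or.inl h, h'⟩, ⟨b, Or.inr h, h'⟩])
  conv_sup R T := rfl
  tarski R T := Subtype.ext (Set.union_eq_self_of_subset_left (by
    rintro ⟨u, w⟩ ⟨v, h, h', h''⟩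
    exact ⟨S.unit_comp (S.unit_inv (S.subset_unit _ R.2 h)) h', fun h3 => h'' ⟨u, h, h3⟩⟩))

end SetRelationAlgebra

/-- A relation algebra is completely representable if it is isomorphic to a set relation algebra
via an isomorphism that takes every existing sum to the union. -/
def CompletelyRepresentable (A : Type u) [RelationAlgebra A] : Prop :=
  ∃ (U : Type u) (S : SetRelationAlgebra U) (e : A → S.Elem), RelationAlgebra.IsIsomorphism e ∧
    ∀ (X : Set A) (a : A), IsLUB X a → (e a).1 = ⋃ x ∈ X, (e x).1

/-! ### Cyclic group relation algebras -/

/-- An equivalence relation `E` on `I`, positive integers `n x` (the orders of the finite cyclic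
groups `G x`), and a system of positive integers `m x y`, for `(x, y)` in `E`, that satisfies the
index conditions. (The values `m x y` for pairs outside `E` play no role.) -/
structure IndexSystem (I : Type u) where
  E : Setoid I
  n : I → ℕ
  n_pos : ∀ x, 0 < n x
  m : I → I → ℕ
  m_pos : ∀ x y, E x y → 0 < m x y
  dvd_left : ∀ x y, E x y → m x y ∣ n x
  dvd_right : ∀ x y, E x y → m x y ∣ n y
  m_self : ∀ x, m x x = n x
  m_symm : ∀ x y, E x y → m y x = m x y
  gcd_left : ∀ x y z, E x y → E y z → (m x y).gcd (m y z) = (m x y).gcd (m x z)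
  gcd_right : ∀ x y z, E x y → E y z → (m x y).gcd (m x z) = (m x z).gcd (m y z)

namespace IndexSystem

variable {I : Type u} (D : IndexSystem I)

/-- The cyclic group of order `n x`. -/
abbrev G (x : I) : Type := ZMod (D.n x)

/-- The disjoint union of the groups `G x`. -/
abbrev Base : Type u := Σ x : I, D.G x

/-- The subgroup of the multiples of `m x y` in `G x`. -/
def H (x y : I) : AddSubgroup (D.G x) := AddSubgroup.zmultiples ((D.m x y : ℕ) : D.G x)

/-- The subgroup of the multiples of `m x y` in `G y`. -/
def K (x y : I) : AddSubgroup (D.G y) := AddSubgroup.zmultiples ((D.m x y : ℕ) : D.G y)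

theorem dvd_cast {m a b : ℤ} (h : m ∣ a) (e : a = b) : m ∣ b := e ▸ h

theorem intCast_mem_zmultiples {n m : ℕ} (h : m ∣ n) (i : ℤ) :
    (i : ZMod n) ∈ AddSubgroup.zmultiples ((m : ℕ) : ZMod n) ↔ (m : ℤ) ∣ i := by
  rw [AddSubgroup.mem_zmultiples_iff]
  constructor
  · rintro ⟨k, hk⟩
    have h1 : ((k * m : ℤ) : ZMod n) = (i : ZMod n) := by
      rw [← hk]; push_cast; rw [zsmul_eq_mul]
    rw [ZMod.intCast_eq_intCast_iff_dvd_sub] at h1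
    have h2 : (m : ℤ) ∣ i - k * m := (Int.natCast_dvd_natCast.mpr h).trans h1
    have h3 := dvd_add h2 (Dvd.intro_left k rfl : (m : ℤ) ∣ k * m)
    simpa using h3
  · rintro ⟨k, rfl⟩
    refine ⟨k, ?_⟩
    rw [zsmul_eq_mul]; push_cast; ring

theorem mk_intCast_eq {n m : ℕ} (h : m ∣ n) (i j : ℤ) :
    (QuotientAddGroup.mk ((i : ℤ) : ZMod n) :
        ZMod n ⧸ AddSubgroup.zmultiples ((m : ℕ) : ZMod n)) =
      QuotientAddGroup.mk ((j : ℤ) : ZMod n) ↔ (m : ℤ) ∣ j - i := by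
  rw [QuotientAddGroup.eq, ← intCast_mem_zmultiples h]
  push_cast
  rw [neg_add_eq_sub]

/-- For common divisors `m` of `n` and `n'`, the homomorphism from `ℤ/n` modulo the multiples of
`m` to `ℤ/n'` modulo the multiples of `m` taking the coset of `ℓ` to the coset of `ℓ`. -/
def quotientHom (n n' m : ℕ) (h : m ∣ n) (h' : m ∣ n') :
    ZMod n ⧸ AddSubgroup.zmultiples ((m : ℕ) : ZMod n) →+
      ZMod n' ⧸ AddSubgroup.zmultiples ((m : ℕ) : ZMod n') :=
  QuotientAddGroup.lift _
    (ZMod.lift n ⟨(QuotientAddGroup.mk' (AddSubgroup.zmultiples ((m : ℕ) : ZMod n'))).comp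
        (Int.castAddHom (ZMod n')), by
      have := (mk_intCast_eq h' (n : ℤ) 0).mpr (by simpa using Int.natCast_dvd_natCast.mpr h)
      simpa using this⟩)
    (by
      rintro a ha
      obtain ⟨i, rfl⟩ := ZMod.intCast_surjective a
      have h1 := (intCast_mem_zmultiples h i).mp ha
      have h2 := (mk_intCast_eq h' i 0).mpr (by simpa using h1)
      simpa using h2)

theorem quotientHom_mk (n n' m : ℕ) (h : m ∣ n) (h' : m ∣ n') (i : ℤ) :
    quotientHom n n' m h h' (QuotientAddGroup.mk (i : ZMod n)) =
      QuotientAddGroup.mk (i : ZMod n') := by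
  simp [quotientHom]

/-- The quotient isomorphism `φ_xy` from `G x / H x y` to `G y / K x y` determined by
`φ_xy (H x y + ℓ) = K x y + ℓ`. -/
def φ {x y : I} (h : D.E x y) : D.G x ⧸ D.H x y ≃+ D.G y ⧸ D.K x y where
  toFun := quotientHom _ _ _ (D.dvd_left x y h) (D.dvd_right x y h)
  invFun := quotientHom _ _ _ (D.dvd_right x y h) (D.dvd_left x y h)
  left_inv a := by
    obtain ⟨b, rfl⟩ := QuotientAddGroup.mk_surjective a
    obtain ⟨i, rfl⟩ := ZMod.intCast_surjective b
    exact (congrArg _ (quotientHom_mk _ _ _ _ _ i)).trans (quotientHom_mk _ _ _ _ _ i)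
  right_inv a := by
    obtain ⟨b, rfl⟩ := QuotientAddGroup.mk_surjective a
    obtain ⟨i, rfl⟩ := ZMod.intCast_surjective b
    exact (congrArg _ (quotientHom_mk _ _ _ _ _ i)).trans (quotientHom_mk _ _ _ _ _ i)
  map_add' := map_add _

theorem φ_mk {x y : I} (h : D.E x y) (i : ℤ) :
    D.φ h (QuotientAddGroup.mk (i : D.G x)) = QuotientAddGroup.mk (i : D.G y) :=
  quotientHom_mk _ _ _ (D.dvd_left x y h) (D.dvd_right x y h) i

/-- The relation `R_{xy,α} = ⋃ γ, γ × φ_xy (γ + α)`, where `γ` ranges over the cosets of `H x y`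
in `G x`. -/
def R {x y : I} (h : D.E x y) (α : D.G x ⧸ D.H x y) : SetRel D.Base D.Base :=
  ⋃ γ : D.G x ⧸ D.H x y,
    {p | ∃ (a : D.G x) (b : D.G y), p = (⟨x, a⟩, ⟨y, b⟩) ∧
      (QuotientAddGroup.mk a : D.G x ⧸ D.H x y) = γ ∧
      (QuotientAddGroup.mk b : D.G y ⧸ D.K x y) = D.φ h (γ + α)}

/-- The index set of the relations `R_{xy,α}`. -/
abbrev Index : Type u := Σ p : {p : I × I // D.E p.1 p.2}, D.G p.1.1 ⧸ D.H p.1.1 p.1.2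

/-- The collection of all unions of relations `R_{xy,α}`. -/
def carrier : Set (SetRel D.Base D.Base) :=
  {T | ∃ X : Set D.Index, T = ⋃ t ∈ X, D.R t.1.2 t.2}

theorem mem_R {x y : I} (h : D.E x y) (x' y' : I) (i j l : ℤ) :
    (((⟨x', (i : D.G x')⟩, ⟨y', (j : D.G y')⟩) : D.Base × D.Base) ∈
      D.R h (QuotientAddGroup.mk (l : D.G x))) ↔
      x' = x ∧ y' = y ∧ (D.m x y : ℤ) ∣ j - i - l := by
  simp only [R, Set.mem_iUnion, Set.mem_ofPred_eq]
  constructor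
  · rintro ⟨γ, a, b, hp, rfl, hb⟩
    have h1 := (Prod.mk.injEq _ _ _ _).mp hp
    obtain ⟨h1, h2⟩ := h1
    cases h1
    cases h2
    refine ⟨rfl, rfl, ?_⟩
    rw [← QuotientAddGroup.mk_add, ← Int.cast_add, φ_mk] at hb
    have h3 := (mk_intCast_eq (D.dvd_right x y h) j (i + l)).mp hb
    have h4 := (dvd_neg (α := ℤ)).mpr h3
    exact dvd_cast h4 (by ring)
  · rintro ⟨rfl, rfl, hd⟩
    refine ⟨_, i, j, rfl, rfl, ?_⟩
    rw [← QuotientAddGroup.mk_add, ← Int.cast_add, φ_mk]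
    refine (mk_intCast_eq (D.dvd_right x' y' h) j (i + l)).mpr ?_
    have h4 := (dvd_neg (α := ℤ)).mpr hd
    exact dvd_cast h4 (by ring)

theorem mem_carrier_iff (T : SetRel D.Base D.Base) :
    T ∈ D.carrier ↔
      ∀ (x y : I) (i j : ℤ), ((⟨x, (i : D.G x)⟩, ⟨y, (j : D.G y)⟩) : D.Base × D.Base) ∈ T →
        D.E x y ∧ ∀ i' j' : ℤ, (D.m x y : ℤ) ∣ (j' - i') - (j - i) →
          ((⟨x, (i' : D.G x)⟩, ⟨y, (j' : D.G y)⟩) : D.Base × D.Base) ∈ T := by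
  constructor
  · rintro ⟨X, rfl⟩ x y i j hT
    simp only [Set.mem_iUnion] at hT
    obtain ⟨⟨⟨⟨x0, y0⟩, h⟩, α⟩, ht, hm⟩ := hT
    obtain ⟨a, rfl⟩ := QuotientAddGroup.mk_surjective α
    obtain ⟨l, rfl⟩ := ZMod.intCast_surjective a
    have hm' := (D.mem_R h x y i j l).mp hm
    obtain ⟨rfl, rfl, hd⟩ := hm'
    refine ⟨h, fun i' j' hd' => ?_⟩
    simp only [Set.mem_iUnion]
    refine ⟨_, ht, (D.mem_R h x y i' j' l).mpr ⟨rfl, rfl, ?_⟩⟩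
    have := dvd_add hd' hd
    exact dvd_cast this (by ring)
  · intro hT
    refine ⟨{t | D.R t.1.2 t.2 ⊆ T}, Set.Subset.antisymm ?_ ?_⟩
    · rintro ⟨⟨x, a⟩, ⟨y, b⟩⟩ hp
      obtain ⟨i, rfl⟩ := ZMod.intCast_surjective a
      obtain ⟨j, rfl⟩ := ZMod.intCast_surjective b
      obtain ⟨h, h'⟩ := hT x y i j hp
      simp only [Set.mem_iUnion]
      refine ⟨⟨⟨(x, y), h⟩, QuotientAddGroup.mk ((j - i : ℤ) : D.G x)⟩, ?_,
        (D.mem_R h x y i j (j - i)).mpr ⟨rfl, rfl, by simp⟩⟩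
      rintro ⟨⟨x', a⟩, ⟨y', b⟩⟩ hq
      obtain ⟨i', rfl⟩ := ZMod.intCast_surjective a
      obtain ⟨j', rfl⟩ := ZMod.intCast_surjective b
      have hq' := (D.mem_R h x' y' i' j' (j - i)).mp hq
      obtain ⟨rfl, rfl, hd⟩ := hq'
      exact h' i' j' hd
    · exact Set.iUnion₂_subset fun t ht => ht

/-- Two congruences are simultaneously solvable when they agree modulo the gcd. -/
theorem exists_solution (p q : ℕ) (a b : ℤ) (h : ((p.gcd q : ℕ) : ℤ) ∣ b - a) :
    ∃ c : ℤ, (p : ℤ) ∣ c - a ∧ (q : ℤ) ∣ c - b := by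
  obtain ⟨k, hk⟩ := h
  rw [Nat.gcd_eq_gcd_ab] at hk
  refine ⟨a + p * p.gcdA q * k, ⟨p.gcdA q * k, by ring⟩, ⟨-(p.gcdB q * k), ?_⟩⟩
  linear_combination -hk

/-- The cyclic group relation algebra determined by an index system. -/
def algebra : SetRelationAlgebra D.Base where
  carrier := D.carrier
  unit := {p | D.E p.1.1 p.2.1}
  unit_mem := (D.mem_carrier_iff _).mpr fun _ _ _ _ h => ⟨h, fun _ _ _ => h⟩
  subset_unit T hT := by
    rintro ⟨⟨x, a⟩, ⟨y, b⟩⟩ hp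
    obtain ⟨i, rfl⟩ := ZMod.intCast_surjective a
    obtain ⟨j, rfl⟩ := ZMod.intCast_surjective b
    exact ((D.mem_carrier_iff T).mp hT x y i j hp).1
  union_mem T hT V hV := by
    rw [mem_carrier_iff] at hT hV ⊢
    rintro x y i j (h | h)
    · exact ⟨(hT x y i j h).1, fun i' j' hd => Or.inl ((hT x y i j h).2 i' j' hd)⟩
    · exact ⟨(hV x y i j h).1, fun i' j' hd => Or.inr ((hV x y i j h).2 i' j' hd)⟩
  compl_mem T hT := by
    rw [mem_carrier_iff] at hT ⊢
    rintro x y i j ⟨h, h'⟩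
    refine ⟨h, fun i' j' hd => ⟨h, fun hc => h' ?_⟩⟩
    refine (hT x y i' j' hc).2 i j ?_
    have := (dvd_neg (α := ℤ)).mpr hd
    exact dvd_cast this (by ring)
  comp_mem T hT V hV := by
    rw [mem_carrier_iff] at hT hV ⊢
    rintro x z i k ⟨⟨y, b⟩, h, h'⟩
    obtain ⟨j, rfl⟩ := ZMod.intCast_surjective b
    obtain ⟨hxy, hT'⟩ := hT x y i j h
    obtain ⟨hyz, hV'⟩ := hV y z j k h'
    refine ⟨D.E.trans' hxy hyz, fun i' k' hd => ?_⟩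
    have hg : (((D.m x y).gcd (D.m y z) : ℕ) : ℤ) ∣ (k' - (k - j)) - (i' + (j - i)) := by
      have h1 : (((D.m x y).gcd (D.m y z) : ℕ) : ℤ) ∣ (D.m x z : ℤ) := by
        rw [D.gcd_left x y z hxy hyz]
        exact Int.natCast_dvd_natCast.mpr (Nat.gcd_dvd_right _ _)
      have h2 := h1.trans hd
      exact dvd_cast h2 (by ring)
    obtain ⟨c, hc1, hc2⟩ := exists_solution _ _ _ _ hg
    refine ⟨⟨y, (c : D.G y)⟩, hT' i' c ?_, hV' c k' ?_⟩
    · exact dvd_cast hc1 (by ring)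
    · have := (dvd_neg (α := ℤ)).mpr hc2
      exact dvd_cast this (by ring)
  inv_mem T hT := by
    rw [mem_carrier_iff] at hT ⊢
    intro x y i j h
    obtain ⟨hyx, hT'⟩ := hT y x j i h
    refine ⟨D.E.symm' hyx, fun i' j' hd => hT' j' i' ?_⟩
    rw [D.m_symm y x hyx] at hd
    have := (dvd_neg (α := ℤ)).mpr hd
    exact dvd_cast this (by ring)
  id_mem := by
    rw [mem_carrier_iff]
    intro x y i j h
    have h1 : (⟨x, (i : D.G x)⟩ : D.Base) = ⟨y, (j : D.G y)⟩ := h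
    obtain rfl : x = y := congrArg Sigma.fst h1
    have h2 : (i : D.G x) = (j : D.G x) := eq_of_heq (Sigma.mk.inj h1).2
    refine ⟨D.E.refl' x, fun i' j' hd => ?_⟩
    change (⟨x, (i' : D.G x)⟩ : D.Base) = ⟨x, (j' : D.G x)⟩
    rw [D.m_self] at hd
    have h3 := (ZMod.intCast_eq_intCast_iff_dvd_sub i j (D.n x)).mp h2
    have h4 : (i' : D.G x) = (j' : D.G x) := by
      refine (ZMod.intCast_eq_intCast_iff_dvd_sub i' j' (D.n x)).mpr ?_
      have := dvd_add hd h3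
      exact dvd_cast this (by ring)
    rw [h4]

end IndexSystem

end RelAlg

/-!
The atoms below a rectangle `x;1;y`, with `x` and `y` measurable atoms, form a transitive `G_x`-set;
let `m_xy` be their number. If each `G_x` is finite and cyclic, one can choose generators `g_x` such
that `g_x;a = a;g_y` for all atoms `a ≤ x;1;y`, by recursion along a well-order: each atom fixes the
generator modulo some `m_xy`, these congruences are compatible modulo the greatest common divisors,
and they are simultaneously solvable because every `m_xy` divides the order of `G_x`. A second
recursion of the same kind yields a scaffold: an atom `a_xy` in each nonempty rectangle, with `a_yx`
the converse of `a_xy` and `a_xz ≤ a_xy;a_yz`. Now the atoms are `g_x^k;a_xy`, with `k` taken modulo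
`m_xy`; sending them to the relations `R_{xy,k}` embeds the algebra in a cyclic group relation
algebra, in which all unions of the `R_{xy,k}` exist, so that it is the completion.
-/

namespace RelAlg

section Congruences

variable {ι : Type*} {d : ι → ℕ} {r : ι → ℤ} {n p : ℕ}

theorem exists_local_residue (hp : p.Prime) (hn : n ≠ 0) (hd : ∀ i, d i ∣ n)
    (hr : ∀ i j, ((Nat.gcd (d i) (d j) : ℕ) : ℤ) ∣ r i - r j) :
    ∃ t : ℤ, (∀ i e, p ^ e ∣ d i → ((p ^ e : ℕ) : ℤ) ∣ t - r i) ∧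
      ((∀ i, IsCoprime (r i) (d i)) → IsCoprime t p) := by
  by_cases hex : ∃ i, p ∣ d i
  · obtain ⟨i, hi, hmax⟩ : ∃ i, p ∣ d i ∧ ∀ j e, p ^ e ∣ d j → p ^ e ∣ d i := by
      obtain ⟨i₀, hi₀⟩ := hex
      let s : Set ℕ := {e | ∃ i, p ^ e ∣ d i}
      have hbdd : BddAbove s := ⟨n, fun e ⟨i, hi⟩ =>
        (Nat.lt_pow_self hp.one_lt).le.trans
          (Nat.le_of_dvd (Nat.pos_of_ne_zero hn) (hi.trans (hd i)))⟩
      have h1 : 1 ∈ s := ⟨i₀, by simpa using hi₀⟩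
      obtain ⟨i, hi⟩ := Nat.sSup_mem ⟨1, h1⟩ hbdd
      exact ⟨i, (dvd_pow_self p (Nat.one_le_iff_ne_zero.mp (le_csSup hbdd h1))).trans hi,
        fun j e hj => (pow_dvd_pow p (le_csSup hbdd ⟨j, hj⟩)).trans hi⟩
    refine ⟨r i, fun j e hj => ?_, fun hcop => (hcop i).of_isCoprime_of_dvd_right ?_⟩
    · exact (Int.natCast_dvd_natCast.mpr (Nat.dvd_gcd (hmax j e hj) hj)).trans (hr i j)
    · exact Int.natCast_dvd_natCast.mpr hi
  · refine ⟨1, fun i e hi => ?_, fun _ => isCoprime_one_left⟩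
    obtain rfl : e = 0 := by
      by_contra he
      exact hex ⟨i, (dvd_pow_self p he).trans hi⟩
    simp

theorem exists_simultaneous_residue (hn : n ≠ 0) (hd : ∀ i, d i ∣ n)
    (hr : ∀ i j, ((Nat.gcd (d i) (d j) : ℕ) : ℤ) ∣ r i - r j) :
    ∃ k : ℤ, (∀ i, (d i : ℤ) ∣ k - r i) ∧
      ((∀ i, IsCoprime (r i) (d i)) → IsCoprime k n) := by
  choose t ht htcop using fun p : n.primeFactors =>
    exists_local_residue (Nat.prime_of_mem_primeFactors p.2) hn hd hr
  let q (p : n.primeFactors) : ℕ := (p : ℕ) ^ n.factorization p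
  have hq : Pairwise (Function.onFun IsCoprime fun p => Ideal.span {(q p : ℤ)}) :=
    fun p p' hne => (Ideal.isCoprime_span_singleton_iff _ _).mpr <|
      Nat.isCoprime_iff_coprime.mpr <| ((Nat.coprime_primes (Nat.prime_of_mem_primeFactors p.2)
        (Nat.prime_of_mem_primeFactors p'.2)).mpr (Subtype.coe_ne_coe.mpr hne)).pow _ _
  obtain ⟨k, hk⟩ := Ideal.exists_forall_sub_mem_ideal hq t
  simp only [Ideal.mem_span_singleton] at hk
  refine ⟨k, fun i => ?_, fun hcop => ?_⟩
  · refine Int.natCast_dvd.mpr ((Nat.dvd_iff_prime_pow_dvd_dvd _ _).mpr fun p e hp he => ?_)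
    rcases Nat.eq_zero_or_pos e with rfl | hpos
    · simp
    have hen : p ^ e ∣ n := he.trans (hd i)
    let p' : n.primeFactors :=
      ⟨p, Nat.mem_primeFactors.mpr ⟨hp, (dvd_pow_self p hpos.ne').trans hen, hn⟩⟩
    have hkt : ((p ^ e : ℕ) : ℤ) ∣ k - t p' := (Int.natCast_dvd_natCast.mpr
      (pow_dvd_pow p ((hp.pow_dvd_iff_le_factorization hn).mp hen))).trans (hk p')
    have htr : ((p ^ e : ℕ) : ℤ) ∣ t p' - r i := ht p' i e he
    exact Int.natCast_dvd.mp (by simpa using hkt.add htr)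
  · refine Int.isCoprime_iff_gcd_eq_one.mpr (Nat.Coprime.gcd_eq_one ?_)
    refine Nat.coprime_of_dvd fun p hp hpk hpn => ?_
    let p' : n.primeFactors := ⟨p, Nat.mem_primeFactors.mpr ⟨hp, hpn, hn⟩⟩
    have hpq : (p : ℤ) ∣ k - t p' := (Int.natCast_dvd_natCast.mpr (dvd_pow_self p
      (Nat.one_le_iff_ne_zero.mp ((hp.dvd_iff_one_le_factorization hn).mp hpn)))).trans (hk p')
    have hpt : (p : ℤ) ∣ t p' := (dvd_sub_right (Int.natCast_dvd.mpr hpk)).mp hpq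
    exact (Nat.prime_iff_prime_int.mp hp).not_isUnit ((htcop p' hcop).isUnit_of_dvd' hpt dvd_rfl)

end Congruences

theorem exists_forall_rel_of_wellFounded {ι : Type*} {β : ι → Type*} [∀ i, Nonempty (β i)]
    {r : ι → ι → Prop} (hr : WellFounded r) {P : ∀ {i j}, β i → β j → Prop}
    (step : ∀ i (f : ∀ j, β j), (∀ j k, r j i → r k j → P (f j) (f k)) →
      ∃ b : β i, ∀ j, r j i → P b (f j)) :
    ∃ f : ∀ i, β i, ∀ i j, r j i → P (f i) (f j) := by
  let f : ∀ i, β i := hr.fix fun i ih => Classical.epsilon fun b => ∀ j (h : r j i), P b (ih j h)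
  have hf (i) : f i = Classical.epsilon fun b => ∀ j, r j i → P b (f j) := hr.fix_eq _ i
  refine ⟨f, fun i => ?_⟩
  induction i using hr.induction with | _ i ih
  rw [hf i]
  exact Classical.epsilon_spec (step i f fun j k hj => ih j hj k)

theorem forall_of_trichotomous {ι : Type*} (r : ι → ι → Prop) [Std.Trichotomous r]
    {T : ι → ι → ι → Prop} (swap : ∀ {x y z}, T x y z → T y x z)
    (reverse : ∀ {x y z}, T x y z → T z y x) (diag : ∀ x z, T x x z)
    (ordered : ∀ {x y z}, r x y → r y z → T x y z) (x y z : ι) : T x y z := by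
  rcases trichotomous_of r x y with hxy | hxy | hxy <;>
  rcases trichotomous_of r y z with hyz | hyz | hyz <;>
  rcases trichotomous_of r x z with hxz | hxz | hxz <;>
  grind

theorem zpow_smul_eq_zpow_smul {M N α : Type*} [Group M] [Group N] [MulAction M α]
    [MulAction N α] [SMulCommClass M N α] {m : M} {n : N} {a : α} (h : m • a = n • a) (k : ℤ) :
    m ^ k • a = n ^ k • a := by
  have h' : m⁻¹ • a = n⁻¹ • a := by
    rw [inv_smul_eq_iff, smul_comm, h, inv_smul_smul]
  induction k with
  | zero => simp only [zpow_zero, one_smul]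
  | succ k ih => rw [zpow_add_one, mul_smul, h, smul_comm, ih, add_comm, zpow_one_add, mul_smul]
  | pred k ih =>
    rw [sub_eq_add_neg, zpow_add, mul_smul, zpow_neg_one, h', smul_comm, ih, add_comm, zpow_add,
      mul_smul, zpow_neg_one]

namespace IndexSystem

/-! ### Points of a cyclic group relation algebra -/

variable {I : Type u} (D : IndexSystem I)

/-- The residue class of the integer `i` in the group `G x`, as a point of the base set. -/
abbrev point (x : I) (i : ℤ) : D.Base := ⟨x, (i : D.G x)⟩

variable {D}

theorem exists_eq_point (p : D.Base) : ∃ x i, p = D.point x i :=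
  have ⟨i, hi⟩ := ZMod.intCast_surjective p.2
  ⟨p.1, i, Sigma.ext rfl (heq_of_eq hi.symm)⟩

theorem rel_subset_iff {R T : SetRel D.Base D.Base} :
    R ⊆ T ↔ ∀ x y i j, (D.point x i, D.point y j) ∈ R → (D.point x i, D.point y j) ∈ T := by
  refine ⟨fun h _ _ _ _ hp => h hp, fun h ⟨p, q⟩ hpq => ?_⟩
  obtain ⟨x, i, rfl⟩ := exists_eq_point p
  obtain ⟨y, j, rfl⟩ := exists_eq_point q
  exact h x y i j hpq

theorem rel_ext {R T : SetRel D.Base D.Base}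
    (h : ∀ x y i j, (D.point x i, D.point y j) ∈ R ↔ (D.point x i, D.point y j) ∈ T) : R = T :=
  Set.Subset.antisymm (rel_subset_iff.mpr fun x y i j => (h x y i j).mp)
    (rel_subset_iff.mpr fun x y i j => (h x y i j).mpr)

theorem point_eq_point_iff {x y : I} {i j : ℤ} :
    D.point x i = D.point y j ↔ x = y ∧ (D.m x y : ℤ) ∣ j - i := by
  constructor
  · intro h
    obtain rfl : x = y := congrArg Sigma.fst h
    rw [D.m_self]
    exact ⟨rfl, (ZMod.intCast_eq_intCast_iff_dvd_sub i j _).mp (eq_of_heq (Sigma.mk.inj h).2)⟩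
  · rintro ⟨rfl, h⟩
    rw [D.m_self] at h
    exact congrArg (Sigma.mk x) ((ZMod.intCast_eq_intCast_iff_dvd_sub i j _).mpr h)

theorem exists_isLUB (X : Set D.algebra.Elem) : ∃ T, IsLUB X T := by
  refine ⟨⟨⋃ T ∈ X, T.1, (D.mem_carrier_iff _).mpr fun x y i j h => ?_⟩,
    fun T hT => Set.subset_biUnion_of_mem (u := fun T : D.algebra.Elem => T.1) hT,
    fun T hT => Set.iUnion₂_subset fun V hV => hT hV⟩
  obtain ⟨T, hT, hp⟩ := Set.mem_iUnion₂.mp h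
  obtain ⟨hE, hclosed⟩ := (D.mem_carrier_iff T.1).mp T.2 x y i j hp
  exact ⟨hE, fun i' j' hd => Set.mem_iUnion₂.mpr ⟨T, hT, hclosed i' j' hd⟩⟩

end IndexSystem

namespace RelationAlgebra

open scoped RightActions

section Arithmetic

variable {A : Type u} [RelationAlgebra A] {a b c x y z : A}

theorem bot_comp (a : A) : comp ⊥ a = ⊥ := by
  rw [← conv_conv (comp ⊥ a), conv_comp, conv_bot, comp_bot, conv_bot]

variable (A) in
/-- Converse as an automorphism of the underlying lattice. -/
def convOrderIso : A ≃o A where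
  toFun := conv
  invFun := conv
  left_inv := conv_conv
  right_inv := conv_conv
  map_rel_iff' := ⟨fun h => by simpa only [Equiv.coe_fn_mk, conv_conv] using conv_mono h, conv_mono⟩

theorem conv_top : conv (⊤ : A) = ⊤ :=
  map_top (convOrderIso A)

theorem conv_eq_bot : conv a = ⊥ ↔ a = ⊥ :=
  map_eq_bot_iff (convOrderIso A)

theorem isAtom_conv : IsAtom (conv a) ↔ IsAtom a :=
  (convOrderIso A).isAtom_iff a

theorem disjoint_conv : Disjoint (conv a) (conv b) ↔ Disjoint a b :=
  disjoint_map_orderIso_iff (convOrderIso A)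

theorem conv_le_comm : conv a ≤ b ↔ a ≤ conv b :=
  (convOrderIso A).to_galoisConnection a b

theorem disjoint_comp_left : Disjoint (comp a b) c ↔ Disjoint b (comp (conv a) c) := by
  rw [disjoint_comm (a := b), ← le_compl_iff_disjoint_right, ← le_compl_iff_disjoint_right]
  exact ⟨cycle, fun h => by simpa only [conv_conv] using cycle h⟩

theorem disjoint_comp_right : Disjoint (comp a b) c ↔ Disjoint a (comp c (conv b)) := by
  rw [← disjoint_conv, conv_comp, disjoint_comp_left, ← disjoint_conv (a := a), conv_comp]

theorem le_conv_comp_of_le_comp (hb : IsAtom b) (hc : IsAtom c) (h : c ≤ comp a b) :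
    b ≤ comp (conv a) c := by
  rw [← hb.not_disjoint_iff_le, ← disjoint_comp_left, disjoint_comm]
  exact hc.not_disjoint_iff_le.mpr h

theorem le_comp_conv_of_le_comp (ha : IsAtom a) (hc : IsAtom c) (h : c ≤ comp a b) :
    a ≤ comp c (conv b) := by
  rw [← ha.not_disjoint_iff_le, ← disjoint_comp_right, disjoint_comm]
  exact hc.not_disjoint_iff_le.mpr h

/-! ### Rectangles -/

/-- The rectangle `x;1;y`, whose elements are those with domain below `x` and range below `y` when
`x` and `y` are subidentity elements. -/
def rect (x y : A) : A := comp (comp x ⊤) y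

theorem conv_rect (hx : x ≤ ident) (hy : y ≤ ident) : conv (rect x y) = rect y x := by
  rw [rect, conv_comp, conv_comp, conv_eq_self hx, conv_eq_self hy, conv_top, comp_assoc, rect]

theorem conv_le_rect (hx : x ≤ ident) (hy : y ≤ ident) (h : a ≤ rect x y) : conv a ≤ rect y x :=
  (conv_mono h).trans (conv_rect hx hy).le

theorem comp_le_rect (ha : a ≤ rect x y) (hb : b ≤ rect y z) : comp a b ≤ rect x z :=
  calc comp a b ≤ comp (rect x y) (rect y z) := comp_mono ha hb
    _ = comp (comp x (comp ⊤ (comp (comp y y) ⊤))) z := by simp only [rect, comp_assoc]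
    _ ≤ rect x z := comp_mono_left _ (comp_mono_right _ le_top)

theorem comp_eq_of_le_rect_left (hx : x ≤ ident) (h : a ≤ rect x y) : comp x a = a := by
  refine le_antisymm ((comp_mono_left a hx).trans (ident_comp a).le) ?_
  calc a = comp x (comp ⊤ y) ⊓ a := by rw [comp_assoc, ← rect, inf_eq_right.mpr h]
    _ ≤ comp x (comp ⊤ y ⊓ comp (conv x) a) := modular _ _ _
    _ ≤ comp x (comp (conv x) a) := comp_mono_right _ inf_le_right
    _ = comp x a := by rw [comp_assoc, conv_eq_self hx, comp_self hx]

theorem comp_eq_of_le_rect_right (hx : x ≤ ident) (hy : y ≤ ident) (h : a ≤ rect x y) :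
    comp a y = a := by
  rw [← conv_conv (comp a y), conv_comp, conv_eq_self hy,
    comp_eq_of_le_rect_left hy (conv_le_rect hx hy h), conv_conv]

theorem le_rect_of_comp_eq (hx : comp x a = a) (hy : comp a y = a) : a ≤ rect x y :=
  calc a = comp (comp x a) y := by rw [hx, hy]
    _ ≤ rect x y := comp_mono_left _ (comp_mono_right _ le_top)

theorem le_rect_self (hx : x ≤ ident) : x ≤ rect x x :=
  le_rect_of_comp_eq (comp_self hx) (comp_self hx)

theorem le_conv_comp_self (hx : x ≤ ident) (hy : y ≤ ident) (hyA : IsAtom y) (h : a ≤ rect x y)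
    (ha : a ≠ ⊥) : y ≤ comp (conv a) a := by
  rw [← hyA.not_disjoint_iff_le, ← disjoint_comp_left, comp_eq_of_le_rect_right hx hy h,
    disjoint_self]
  exact ha

theorem comp_ne_bot (hx : x ≤ ident) (hy : y ≤ ident) (hyA : IsAtom y) (ha : a ≤ rect x y)
    (hb : b ≤ rect y z) (ha₀ : a ≠ ⊥) (hb₀ : b ≠ ⊥) : comp a b ≠ ⊥ := by
  intro h
  refine hb₀ (le_bot_iff.mp ?_)
  calc b = comp y b := (comp_eq_of_le_rect_left hy hb).symm
    _ ≤ comp (comp (conv a) a) b := comp_mono_left b (le_conv_comp_self hx hy hyA ha ha₀)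
    _ = ⊥ := by rw [← comp_assoc, h, comp_bot]

end Arithmetic

section MeasurableAtoms

variable {A : Type u} [RelationAlgebra A]

variable (A) in
/-- The type of measurable atoms, which are the indices of the rectangles considered below. -/
abbrev MAtom : Type u := {x : A // IsMeasurableAtom x}

variable {w x y z : MAtom A} {a b c d r : A}

namespace AtomGroup

theorem le_rect (f : AtomGroup x) : f.1 ≤ rect x.1 x.1 := f.2.2.1

theorem conv_comp_comp (f : AtomGroup x) (ha : a ≤ rect x.1 b) :
    comp (conv f.1) (comp f.1 a) = a := by
  rw [comp_assoc, conv_comp_self_eq x.2.isAtom x.2.le_ident f.2,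
    comp_eq_of_le_rect_left x.2.le_ident ha]

theorem comp_conv_comp (f : AtomGroup x) (ha : a ≤ rect x.1 b) :
    comp f.1 (comp (conv f.1) a) = a := by
  simpa only [show (f⁻¹).1 = conv f.1 from rfl, conv_conv] using f⁻¹.conv_comp_comp ha

theorem isAtom_comp (f : AtomGroup x) (ha : IsAtom a) (h : a ≤ rect x.1 b) :
    IsAtom (comp f.1 a) := by
  have eq_bot_of_comp {c : A} (f : AtomGroup x) (hc : c ≤ rect x.1 b) (h : comp f.1 c = ⊥) :
      c = ⊥ := by rw [← f.conv_comp_comp hc, h, comp_bot]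
  refine isAtom_iff_le_of_ge.mpr ⟨fun h₀ => ha.1 (eq_bot_of_comp f h h₀), fun c hc hle => ?_⟩
  have hcr : c ≤ rect x.1 b := hle.trans (comp_le_rect f.le_rect h)
  have hca : comp (conv f.1) c = a := (ha.le_iff_eq fun h₀ => hc (eq_bot_of_comp f⁻¹ hcr h₀)).mp <|
    (comp_mono_right _ hle).trans (f.conv_comp_comp h).le
  rw [← hca, f.comp_conv_comp hcr]

theorem isAtom (f : AtomGroup x) : IsAtom f.1 := by
  have h := f.isAtom_comp x.2.isAtom (le_rect_self x.2.le_ident)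
  rwa [comp_eq_of_le_rect_right x.2.le_ident x.2.le_ident f.le_rect] at h

theorem isAtom_comp_right (f : AtomGroup y) (ha : IsAtom a) (hb : b ≤ ident)
    (h : a ≤ rect b y.1) : IsAtom (comp a f.1) := by
  rw [← isAtom_conv, conv_comp]
  exact f⁻¹.isAtom_comp (isAtom_conv.mpr ha) (conv_le_rect hb y.2.le_ident h)

theorem exists_le (ha : a ≤ rect x.1 x.1) (h₀ : a ≠ ⊥) : ∃ f : AtomGroup x, f.1 ≤ a := by
  by_contra! hnot
  have hdisj : square x.1 ≤ aᶜ := x.2.isLUB.2 fun f hf =>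
    le_compl_iff_disjoint_right.mpr <| not_not.mp fun hd =>
      hnot ⟨f, hf⟩ ((isAtom ⟨f, hf⟩).not_disjoint_iff_le.mp hd)
  exact h₀ (disjoint_self.mp (le_compl_iff_disjoint_right.mp (ha.trans hdisj)))

theorem exists_not_disjoint_comp (ha : a ≤ rect x.1 y.1) (hb : b ≤ rect x.1 y.1) (ha₀ : a ≠ ⊥)
    (hb₀ : b ≠ ⊥) : ∃ f : AtomGroup x, ¬ Disjoint (comp f.1 a) b := by
  have ha' := conv_le_rect x.2.le_ident y.2.le_ident ha
  obtain ⟨f, hf⟩ := exists_le (comp_le_rect hb ha') <|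
    comp_ne_bot x.2.le_ident y.2.le_ident y.2.isAtom hb ha' hb₀ (conv_eq_bot.not.mpr ha₀)
  exact ⟨f, by rwa [disjoint_comp_right, f.isAtom.not_disjoint_iff_le]⟩

theorem exists_le_comp_comp (hr : r ≤ rect y.1 y.1) (hc : IsAtom c)
    (h : c ≤ comp a (comp r d)) :
    ∃ f : AtomGroup y, f.1 ≤ r ∧ c ≤ comp a (comp f.1 d) := by
  have disjoint_comp_comp (s : A) :
      Disjoint (comp a (comp s d)) c ↔ Disjoint s (comp (comp (conv a) c) (conv d)) := by
    rw [disjoint_comp_left, disjoint_comp_right]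
  have hmeet : r ⊓ comp (comp (conv a) c) (conv d) ≠ ⊥ := by
    rw [Ne, ← disjoint_iff, ← disjoint_comp_comp, disjoint_comm]
    exact hc.not_disjoint_iff_le.mpr h
  obtain ⟨f, hf⟩ := exists_le (inf_le_left.trans hr) hmeet
  refine ⟨f, hf.trans inf_le_left, ?_⟩
  rw [← hc.not_disjoint_iff_le, disjoint_comm, disjoint_comp_comp, f.isAtom.not_disjoint_iff_le]
  exact hf.trans inf_le_right

end AtomGroup

/-- A nonzero `b` for which the set of `f ∈ G_x` with `f;b` meeting `b` is minimal is an atom: if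
`⊥ < c < b`, then some `f` moves a part of `c` into `b \ c`, and this `f` is lost for that part. -/
theorem exists_isAtom_le_of_le_rect [Finite (AtomGroup x)] (ha : a ≤ rect x.1 y.1)
    (h₀ : a ≠ ⊥) : ∃ b, IsAtom b ∧ b ≤ a := by
  let overlap (b : A) : Set (AtomGroup x) := {f | ¬ Disjoint (comp f.1 b) b}
  obtain ⟨b, ⟨hb₀, hba⟩, hmin⟩ := (InvImage.wf overlap wellFounded_lt).has_min
    {b | b ≠ ⊥ ∧ b ≤ a} ⟨a, h₀, le_rfl⟩
  refine ⟨b, isAtom_iff_le_of_ge.mpr ⟨hb₀, fun c hc₀ hcb => ?_⟩, hba⟩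
  by_contra hbc
  have hbc₀ : b \ c ≠ ⊥ := sdiff_eq_bot_iff.not.mpr hbc
  have hb := hba.trans ha
  obtain ⟨f, hf⟩ := AtomGroup.exists_not_disjoint_comp (hcb.trans hb) (sdiff_le.trans hb) hc₀ hbc₀
  let e := c ⊓ comp (conv f.1) (b \ c)
  have he₀ : e ≠ ⊥ := by rwa [disjoint_comp_left, disjoint_iff] at hf
  have heb : e ≤ b := inf_le_left.trans hcb
  have hfe : comp f.1 e ≤ b \ c := (comp_mono_right _ inf_le_right).trans
    (f.comp_conv_comp (sdiff_le.trans hb)).le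
  refine hmin e ⟨he₀, heb.trans hba⟩ (Set.ssubset_iff_exists.mpr ⟨fun g hg hd => hg ?_, f, ?_, ?_⟩)
  · exact hd.mono (comp_mono_right _ heb) heb
  · intro hd
    have hfe₀ := le_bot_iff.mp (hd (comp_mono_right f.1 heb) (hfe.trans sdiff_le))
    exact he₀ (by rw [← f.conv_comp_comp (heb.trans hb), hfe₀, comp_bot])
  · exact not_not.mpr (disjoint_sdiff_self_left.mono hfe inf_le_left)

/-- The atoms below the rectangle `x;1;y`. The groups `G_x` and `G_y` act on them by relative
multiplication from the left and from the right. -/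
def RectAtom (x y : MAtom A) : Type u := {a : A // IsAtom a ∧ a ≤ rect x.1 y.1}

namespace RectAtom

instance : MulAction (AtomGroup x) (RectAtom x y) where
  smul f a := ⟨comp f.1 a.1, f.isAtom_comp a.2.1 a.2.2, comp_le_rect f.le_rect a.2.2⟩
  one_smul a := Subtype.ext (comp_eq_of_le_rect_left x.2.le_ident a.2.2)
  mul_smul f g a := Subtype.ext (comp_assoc f.1 g.1 a.1).symm

instance : MulAction (AtomGroup y)ᵐᵒᵖ (RectAtom x y) where
  smul f a := ⟨comp a.1 f.unop.1, f.unop.isAtom_comp_right a.2.1 x.2.le_ident a.2.2,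
    comp_le_rect a.2.2 f.unop.le_rect⟩
  one_smul a := Subtype.ext (comp_eq_of_le_rect_right x.2.le_ident y.2.le_ident a.2.2)
  mul_smul f g a := Subtype.ext (comp_assoc a.1 g.unop.1 f.unop.1)

instance : SMulCommClass (AtomGroup x) (AtomGroup y)ᵐᵒᵖ (RectAtom x y) where
  smul_comm f g a := Subtype.ext (comp_assoc f.1 a.1 g.unop.1)

theorem coe_smul (f : AtomGroup x) (a : RectAtom x y) : (f • a).1 = comp f.1 a.1 := rfl

theorem coe_op_smul (f : AtomGroup y) (a : RectAtom x y) : (a <• f).1 = comp a.1 f.1 := rfl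

theorem ext_of_le {a b : RectAtom x y} (h : a.1 ≤ b.1) : a = b :=
  Subtype.ext ((b.2.1.le_iff_eq a.2.1.1).mp h)

instance : MulAction.IsPretransitive (AtomGroup x) (RectAtom x y) where
  exists_smul_eq a b :=
    have ⟨f, hf⟩ := AtomGroup.exists_not_disjoint_comp a.2.2 b.2.2 a.2.1.1 b.2.1.1
    ⟨f, ext_of_le ((f • a).2.1.not_disjoint_iff_le.mp hf)⟩

/-- The converse of an atom of a rectangle. -/
def conv (a : RectAtom x y) : RectAtom y x :=
  ⟨RelationAlgebra.conv a.1, isAtom_conv.mpr a.2.1,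
    conv_le_rect x.2.le_ident y.2.le_ident a.2.2⟩

theorem conv_conv (a : RectAtom x y) : a.conv.conv = a :=
  Subtype.ext (RelationAlgebra.conv_conv a.1)

theorem conv_smul (f : AtomGroup x) (a : RectAtom x y) : (f • a).conv = a.conv <• f⁻¹ :=
  Subtype.ext (conv_comp f.1 a.1)

theorem conv_op_smul (f : AtomGroup y) (a : RectAtom x y) : (a <• f).conv = f⁻¹ • a.conv :=
  Subtype.ext (conv_comp a.1 f.1)

instance : MulAction.IsPretransitive (AtomGroup y)ᵐᵒᵖ (RectAtom x y) where
  exists_smul_eq a b := by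
    obtain ⟨f, hf⟩ := MulAction.exists_smul_eq (AtomGroup y) b.conv a.conv
    exact ⟨.op f, by rw [← conv_conv a, ← hf, conv_smul, conv_conv, ← mul_smul]; simp⟩

theorem exists_le [Finite (AtomGroup x)] (ha : a ≤ rect x.1 y.1) (h₀ : a ≠ ⊥) :
    ∃ b : RectAtom x y, b.1 ≤ a :=
  have ⟨b, hb, hba⟩ := exists_isAtom_le_of_le_rect ha h₀
  ⟨⟨b, hb, hba.trans ha⟩, hba⟩

theorem exists_le_comp [Finite (AtomGroup x)] (a : RectAtom x y) (b : RectAtom y z) :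
    ∃ c : RectAtom x z, c.1 ≤ comp a.1 b.1 :=
  exists_le (comp_le_rect a.2.2 b.2.2) <|
    comp_ne_bot x.2.le_ident y.2.le_ident y.2.isAtom a.2.2 b.2.2 a.2.1.1 b.2.1.1

theorem le_comp_conv_left {a : RectAtom x y} {b : RectAtom y z} {c : RectAtom x z}
    (h : c.1 ≤ comp a.1 b.1) : b.1 ≤ comp a.conv.1 c.1 :=
  le_conv_comp_of_le_comp b.2.1 c.2.1 h

theorem le_comp_conv_right {a : RectAtom x y} {b : RectAtom y z} {c : RectAtom x z}
    (h : c.1 ≤ comp a.1 b.1) : a.1 ≤ comp c.1 b.conv.1 :=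
  le_comp_conv_of_le_comp a.2.1 c.2.1 h

theorem conv_le_comp {a : RectAtom x y} {b : RectAtom y z} {c : RectAtom x z}
    (h : c.1 ≤ comp a.1 b.1) : c.conv.1 ≤ comp b.conv.1 a.conv.1 :=
  (conv_mono h).trans (conv_comp a.1 b.1).le

theorem smul_eq_self_iff (f : AtomGroup x) (a : RectAtom x y) :
    f • a = a ↔ f.1 ≤ comp a.1 a.conv.1 := by
  rw [← f.isAtom.not_disjoint_iff_le, conv, ← disjoint_comp_right,
    ← coe_smul, (f • a).2.1.not_disjoint_iff_le]
  exact ⟨fun h => (congrArg Subtype.val h).le, ext_of_le⟩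

/-- The unit of `G_x`, as an atom of `x;1;x`. -/
def refl (x : MAtom A) : RectAtom x x := ⟨x.1, x.2.isAtom, le_rect_self x.2.le_ident⟩

end RectAtom

/-! ### Counting the atoms of a rectangle -/

/-- The number `m_xy` of atoms below `x;1;y`, with value `0` if there are infinitely many. -/
noncomputable def numAtoms (x y : MAtom A) : ℕ := Nat.card (RectAtom x y)

theorem numAtoms_comm (x y : MAtom A) : numAtoms x y = numAtoms y x :=
  Nat.card_congr ⟨RectAtom.conv, RectAtom.conv, RectAtom.conv_conv, RectAtom.conv_conv⟩

theorem numAtoms_dvd_card (a : RectAtom x y) : numAtoms x y ∣ Nat.card (AtomGroup x) := by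
  rw [numAtoms, ← MulAction.index_stabilizer_of_transitive (AtomGroup x) a]
  exact Subgroup.index_dvd_card _

theorem numAtoms_self (x : MAtom A) : numAtoms x x = Nat.card (AtomGroup x) := by
  have hstab : MulAction.stabilizer (AtomGroup x) (RectAtom.refl x) = ⊥ := by
    refine (Subgroup.eq_bot_iff_forall _).mpr fun f hf => Subtype.ext ?_
    have h : comp f.1 x.1 = x.1 := congrArg Subtype.val hf
    rwa [comp_eq_of_le_rect_right x.2.le_ident x.2.le_ident f.le_rect] at h
  rw [numAtoms, ← MulAction.index_stabilizer_of_transitive (AtomGroup x) (RectAtom.refl x), hstab,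
    Subgroup.index_bot]

theorem zpow_smul_eq_self_iff {g : AtomGroup x} (hg : ∀ f, f ∈ Subgroup.zpowers g)
    (a : RectAtom x y) {k : ℤ} : g ^ k • a = a ↔ (numAtoms x y : ℤ) ∣ k := by
  have horbit : MulAction.orbit (Subgroup.zpowers g) a = Set.univ := by
    refine Set.eq_univ_of_forall fun b => ?_
    obtain ⟨f, rfl⟩ := MulAction.exists_smul_eq (AtomGroup x) a b
    exact ⟨⟨f, hg f⟩, rfl⟩
  have hperiod : numAtoms x y = Function.minimalPeriod (g • ·) a := by
    rw [numAtoms, ← Nat.card_univ, ← horbit, Nat.card_congr (MulAction.orbitZPowersEquiv g a),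
      Nat.card_zmod]
  rw [hperiod, MulAction.zpow_smul_eq_iff_minimalPeriod_dvd]

end MeasurableAtoms

section Coherence

variable {A : Type u} [RelationAlgebra A] {w x y z : MAtom A}

/-- Two measurable atoms are linked if some atom lies below the rectangle that they span; this is
the equivalence relation `E` of the index system. -/
def Linked (x y : MAtom A) : Prop := Nonempty (RectAtom x y)

namespace Linked

theorem refl (x : MAtom A) : Linked x x := ⟨.refl x⟩

theorem symm (h : Linked x y) : Linked y x := h.map .conv

theorem trans [Finite (AtomGroup x)] (h : Linked x y) (h' : Linked y z) : Linked x z :=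
  have ⟨c, _⟩ := RectAtom.exists_le_comp h.some h'.some
  ⟨c⟩

end Linked

namespace RectAtom

variable {a : RectAtom x y} {b : RectAtom y z} {c : RectAtom x z} {f g : AtomGroup x}
  {h : AtomGroup y}

theorem exists_smul_eq_op_smul_of_le_comp (hc : c.1 ≤ comp a.1 b.1)
    (hfc : (f • c).1 ≤ comp a.1 b.1) : ∃ h : AtomGroup y, h • b = b ∧ f • a = a <• h := by
  have hfa : (f • a).1 ≤ comp a.1 (comp (comp b.1 b.conv.1) ident) :=
    calc (f • a).1 ≤ comp f.1 (comp c.1 b.conv.1) := comp_mono_right f.1 (le_comp_conv_right hc)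
      _ = comp (f • c).1 b.conv.1 := comp_assoc _ _ _
      _ ≤ comp (comp a.1 b.1) b.conv.1 := comp_mono_left _ hfc
      _ = _ := by rw [comp_ident, comp_assoc]
  obtain ⟨h, hb, ha⟩ :=
    AtomGroup.exists_le_comp_comp (comp_le_rect b.2.2 b.conv.2.2) (f • a).2.1 hfa
  exact ⟨h, (smul_eq_self_iff h b).mpr hb, ext_of_le (by rwa [comp_ident] at ha)⟩

theorem op_zpow_smul {u : ℤ} (h₀ : a <• h = g ^ u • a) (k : ℤ) : a <• h ^ k = g ^ (u * k) • a := by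
  rw [zpow_mul, MulOpposite.op_zpow]
  have : SMulCommClass (AtomGroup y)ᵐᵒᵖ (AtomGroup x) (RectAtom x y) := .symm _ _ _
  exact zpow_smul_eq_zpow_smul h₀ k

theorem gcd_dvd_of_le_comp (hg : ∀ f, f ∈ Subgroup.zpowers g) (hh : ∀ f, f ∈ Subgroup.zpowers h)
    (hc : c.1 ≤ comp a.1 b.1) {k : ℤ} (hkc : (g ^ k • c).1 ≤ comp a.1 b.1) :
    ((Nat.gcd (numAtoms x y) (numAtoms y z) : ℕ) : ℤ) ∣ k := by
  obtain ⟨f, hfb, hfa⟩ := exists_smul_eq_op_smul_of_le_comp hc hkc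
  obtain ⟨j, rfl⟩ := hh f
  obtain ⟨f', hf'⟩ := MulAction.exists_smul_eq (AtomGroup x) a (a <• h)
  obtain ⟨u, rfl⟩ := hg f'
  have hj : (numAtoms y z : ℤ) ∣ j := (zpow_smul_eq_self_iff hh b).mp hfb
  have hk : (numAtoms x y : ℤ) ∣ k - u * j := by
    rw [← zpow_smul_eq_self_iff hg a, sub_eq_neg_add, zpow_add, mul_smul, hfa,
      op_zpow_smul hf'.symm, zpow_neg, inv_smul_smul]
  have hgcd := dvd_add ((Int.natCast_dvd_natCast.mpr (Nat.gcd_dvd_left _ _)).trans hk)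
    (((Int.natCast_dvd_natCast.mpr (Nat.gcd_dvd_right _ _)).trans hj).mul_left u)
  rwa [sub_add_cancel] at hgcd

theorem gcd_numAtoms_dvd [Finite (AtomGroup x)] [IsCyclic (AtomGroup x)] [IsCyclic (AtomGroup y)]
    (hxy : Linked x y) (hyz : Linked y z) :
    Nat.gcd (numAtoms x y) (numAtoms y z) ∣ numAtoms x z := by
  obtain ⟨g, hg⟩ := IsCyclic.exists_generator (α := AtomGroup x)
  obtain ⟨h, hh⟩ := IsCyclic.exists_generator (α := AtomGroup y)
  obtain ⟨c, hc⟩ := exists_le_comp hxy.some hyz.some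
  refine Int.natCast_dvd_natCast.mp (gcd_dvd_of_le_comp hg hh hc ?_)
  rwa [(zpow_smul_eq_self_iff hg c).mpr dvd_rfl]

theorem smul_eq_op_smul_of_smul_eq_op_smul (hg : ∀ f, f ∈ Subgroup.zpowers g)
    (ha : g • a = a <• h) (b : RectAtom x y) : g • b = b <• h := by
  obtain ⟨f, rfl⟩ := MulAction.exists_smul_eq (AtomGroup x) a b
  obtain ⟨k, rfl⟩ := hg f
  change g • g ^ k • a = (g ^ k • a) <• h
  rw [← smul_comm (g ^ k) (MulOpposite.op h) a, ← ha, ← mul_smul, ← mul_smul,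
    mul_self_zpow, mul_zpow_self]

theorem smul_eq_op_smul_self (hg : ∀ f, f ∈ Subgroup.zpowers g) (a : RectAtom x x) :
    g • a = a <• g := by
  refine smul_eq_op_smul_of_smul_eq_op_smul (a := .refl x) hg (Subtype.ext ?_) a
  exact (comp_eq_of_le_rect_right x.2.le_ident x.2.le_ident g.le_rect).trans
    (comp_eq_of_le_rect_left x.2.le_ident g.le_rect).symm

theorem conv_smul_eq_op_smul (ha : g • a = a <• h) : h • a.conv = a.conv <• g := by
  have hinv : (g • a).conv = (a <• h).conv := congrArg conv ha
  rw [conv_smul, conv_op_smul, eq_inv_smul_iff, smul_comm h, MulOpposite.op_inv,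
    inv_smul_eq_iff] at hinv
  exact hinv

end RectAtom

/-! ### Coherent generators -/

variable (A) in
/-- Generators `g_x` of the groups `G_x` which are carried to one another by all atoms of
rectangles. They identify each `G_x` with a cyclic group `ℤ/n_x`, in such a way that the atoms of
`x;1;y` are cosets of the subgroup generated by `m_xy`. -/
structure IsCoherent (g : ∀ x : MAtom A, AtomGroup x) : Prop where
  mem_zpowers : ∀ x f, f ∈ Subgroup.zpowers (g x)
  smul_eq_op_smul : ∀ {x y} (a : RectAtom x y), g x • a = a <• g y

theorem exists_isCoprime_zpow_smul {h : AtomGroup y} (hh : ∀ f, f ∈ Subgroup.zpowers h)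
    {g : AtomGroup x} (hg : ∀ f, f ∈ Subgroup.zpowers g) (a : RectAtom y x) :
    ∃ r : ℤ, IsCoprime r (numAtoms y x) ∧ h ^ r • a = a <• g := by
  obtain ⟨f, hf⟩ := MulAction.exists_smul_eq (AtomGroup y) a (a <• g)
  obtain ⟨r, rfl⟩ := hh f
  obtain ⟨f', hf'⟩ := MulAction.exists_smul_eq (AtomGroup x)ᵐᵒᵖ a (h • a)
  obtain ⟨s, hs⟩ := hg f'.unop
  obtain ⟨t, ht⟩ : (numAtoms y x : ℤ) ∣ r * s - 1 := by
    rw [← zpow_smul_eq_self_iff hh a, sub_eq_neg_add, zpow_add, mul_smul,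
      ← RectAtom.op_zpow_smul hf.symm, zpow_neg_one, inv_smul_eq_iff, ← hf',
      ← MulOpposite.op_unop f', ← hs]
  exact ⟨r, ⟨s, -t, by linear_combination ht⟩, hf⟩

theorem gcd_dvd_sub_of_zpow_smul_eq [Finite (AtomGroup x)] {h : AtomGroup y}
    (hh : ∀ f, f ∈ Subgroup.zpowers h) {g : AtomGroup x}
    (hg : ∀ f, f ∈ Subgroup.zpowers g) {g' : AtomGroup z}
    (hcoh : ∀ b : RectAtom x z, g • b = b <• g') {r r' : ℤ} {a : RectAtom y x} {a' : RectAtom y z}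
    (hr : h ^ r • a = a <• g) (hr' : h ^ r' • a' = a' <• g') :
    ((Nat.gcd (numAtoms y x) (numAtoms y z) : ℕ) : ℤ) ∣ r' - r := by
  obtain ⟨b, hb⟩ := RectAtom.exists_le_comp a.conv a'
  have hc : a'.1 ≤ comp a.1 b.1 := by
    simpa only [RectAtom.conv_conv] using RectAtom.le_comp_conv_left hb
  have hrc : (h ^ (r' - r) • a').1 ≤ comp a.1 b.1 :=
    calc (h ^ (r' - r) • a').1 = comp (h ^ (-r)).1 (a' <• g').1 := by
          rw [← hr', ← RectAtom.coe_smul, ← mul_smul, ← zpow_add, neg_add_eq_sub]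
      _ ≤ comp (h ^ (-r)).1 (comp (comp a.1 b.1) g'.1) := comp_mono_right _ (comp_mono_left _ hc)
      _ = comp (h ^ (-r)).1 (comp a.1 (b <• g').1) := by rw [← comp_assoc]; rfl
      _ = comp (h ^ (-r)).1 (comp (a <• g).1 b.1) := by
        rw [← hcoh]; exact congrArg _ (comp_assoc _ _ _)
      _ = comp (h ^ (-r) • h ^ r • a).1 b.1 := by rw [hr, comp_assoc]; rfl
      _ = comp a.1 b.1 := by rw [zpow_neg, inv_smul_smul]
  refine (Int.natCast_dvd_natCast.mpr (Nat.dvd_gcd (Nat.gcd_dvd_left _ _) ?_)).trans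
    (RectAtom.gcd_dvd_of_le_comp hh hg hc hrc)
  have : IsCyclic (AtomGroup x) := ⟨⟨g, hg⟩⟩
  have : IsCyclic (AtomGroup y) := ⟨⟨h, hh⟩⟩
  rw [numAtoms_comm y x]
  exact RectAtom.gcd_numAtoms_dvd ⟨a.conv⟩ ⟨a'⟩

theorem exists_generator_extending [Finite (AtomGroup y)] [IsCyclic (AtomGroup y)] {ι : Type*}
    {s : ι → MAtom A} [∀ i, Finite (AtomGroup (s i))] {g : ∀ i, AtomGroup (s i)}
    (hg : ∀ i f, f ∈ Subgroup.zpowers (g i))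
    (hcoh : ∀ i j (b : RectAtom (s i) (s j)), g i • b = b <• g j) (a : ∀ i, RectAtom y (s i)) :
    ∃ h : AtomGroup y, (∀ f, f ∈ Subgroup.zpowers h) ∧ ∀ i, h • a i = a i <• g i := by
  obtain ⟨h, hh⟩ := IsCyclic.exists_generator (α := AtomGroup y)
  choose r hcop hr using fun i => exists_isCoprime_zpow_smul hh (hg i) (a i)
  obtain ⟨k, hk, hkcop⟩ := exists_simultaneous_residue (Nat.card_pos (α := AtomGroup y)).ne'
    (fun i => numAtoms_dvd_card (a i))
    (fun i j => Nat.gcd_comm _ _ ▸ gcd_dvd_sub_of_zpow_smul_eq hh (hg j) (hcoh j i) (hr j) (hr i))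
  refine ⟨h ^ k, fun f => ?_, fun i => ?_⟩
  · obtain ⟨u, v, huv⟩ := hkcop hcop
    have hpow : (h ^ k) ^ u = h := by
      rw [← zpow_mul, mul_comm, eq_sub_of_add_eq huv, zpow_sub, zpow_one, mul_comm v, zpow_mul,
        zpow_natCast, pow_card_eq_one', one_zpow, inv_one, mul_one]
    have hle : Subgroup.zpowers h ≤ Subgroup.zpowers (h ^ k) :=
      Subgroup.zpowers_le.mpr (Subgroup.mem_zpowers_iff.mpr ⟨u, hpow⟩)
    exact hle (hh f)
  · rw [← sub_add_cancel k (r i), add_comm, zpow_add, mul_smul,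
      (zpow_smul_eq_self_iff hh (a i)).mpr (hk i), hr i]

theorem smul_eq_op_smul_of_trichotomous {S : Set (MAtom A)} (r : MAtom A → MAtom A → Prop)
    [Std.Trichotomous r] {g : ∀ x : MAtom A, AtomGroup x}
    (hg : ∀ x f, f ∈ Subgroup.zpowers (g x))
    (hr : ∀ x ∈ S, ∀ y ∈ S, r y x → ∀ a : RectAtom x y, g x • a = a <• g y) :
    ∀ x ∈ S, ∀ y ∈ S, ∀ a : RectAtom x y, g x • a = a <• g y := by
  intro x hx y hy a
  rcases trichotomous_of r x y with h | rfl | h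
  · simpa only [RectAtom.conv_conv] using
      RectAtom.conv_smul_eq_op_smul (hr y hy x hx h a.conv)
  · exact RectAtom.smul_eq_op_smul_self (hg x) a
  · exact hr x hx y hy h a

variable (A) in
theorem exists_isCoherent [∀ x : MAtom A, Finite (AtomGroup x)]
    [∀ x : MAtom A, IsCyclic (AtomGroup x)] : ∃ g : ∀ x : MAtom A, AtomGroup x, IsCoherent A g := by
  let Generator (x : MAtom A) : Type u := {g : AtomGroup x // ∀ f, f ∈ Subgroup.zpowers g}
  have hGenerator (x : MAtom A) : Nonempty (Generator x) :=
    have ⟨g, hg⟩ := IsCyclic.exists_generator (α := AtomGroup x)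
    ⟨⟨g, hg⟩⟩
  let r : MAtom A → MAtom A → Prop := WellOrderingRel
  have step (y : MAtom A) (g : ∀ x, Generator x)
      (hg : ∀ x z, r x y → r z x → ∀ a : RectAtom x z, (g x).1 • a = a <• (g z).1) :
      ∃ h : Generator y, ∀ x, r x y → ∀ a : RectAtom y x, h.1 • a = a <• (g x).1 := by
    have hcoh := smul_eq_op_smul_of_trichotomous (S := {x | r x y}) r (fun x => (g x).2)
      fun x hx z _ => hg x z hx
    obtain ⟨h, hh, hha⟩ := exists_generator_extending
      (s := fun i : {x // r x y ∧ Linked y x} => i.1) (fun i => (g i).2)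
      (fun i j => hcoh i i.2.1 j j.2.1) (fun i => i.2.2.some)
    exact ⟨⟨h, hh⟩, fun x hx a =>
      RectAtom.smul_eq_op_smul_of_smul_eq_op_smul hh (hha ⟨x, hx, ⟨a⟩⟩) a⟩
  obtain ⟨g, hg⟩ := exists_forall_rel_of_wellFounded (β := Generator)
    (P := fun {x y} g h => ∀ a : RectAtom x y, (g : Generator x).1 • a = a <• (h : Generator y).1)
    (IsWellFounded.wf (r := r)) step
  exact ⟨fun x => (g x).1, fun x => (g x).2, fun {x y} => smul_eq_op_smul_of_trichotomous
    (S := Set.univ) r (fun x => (g x).2) (fun x _ y _ => hg x y) x trivial y trivial⟩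

end Coherence

section Scaffolds

variable {A : Type u} [RelationAlgebra A] {x y z : MAtom A} {g : ∀ x : MAtom A, AtomGroup x}

/-! ### Scaffolds -/

theorem IsCoherent.zpow_comp_comp_eq (hg : IsCoherent A g) (a : RectAtom x y) (b : RectAtom y z)
    {k : ℤ} (hk : ((Nat.gcd (numAtoms x y) (numAtoms y z) : ℕ) : ℤ) ∣ k) :
    comp (g x ^ k).1 (comp a.1 b.1) = comp a.1 b.1 := by
  obtain ⟨c, rfl⟩ := hk
  obtain ⟨p, q, hpq⟩ : ∃ p q : ℤ, ((Nat.gcd (numAtoms x y) (numAtoms y z) : ℕ) : ℤ) =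
      q + p ∧ (numAtoms x y : ℤ) ∣ p ∧ (numAtoms y z : ℤ) ∣ q :=
    ⟨_, _, (Nat.gcd_eq_gcd_ab _ _).trans (add_comm _ _), dvd_mul_right _ _, dvd_mul_right _ _⟩
  rw [hpq.1, add_mul, zpow_add]
  have ha : g x ^ (p * c) • a = a :=
    (zpow_smul_eq_self_iff (hg.mem_zpowers x) a).mpr (hpq.2.1.mul_right c)
  have hb : g y ^ (q * c) • b = b :=
    (zpow_smul_eq_self_iff (hg.mem_zpowers y) b).mpr (hpq.2.2.mul_right c)
  calc comp (g x ^ (q * c) * g x ^ (p * c)).1 (comp a.1 b.1)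
      = comp ((g x ^ (q * c) * g x ^ (p * c)) • a).1 b.1 := comp_assoc _ _ _
    _ = comp (a <• g y ^ (q * c)).1 b.1 := by
      rw [mul_smul, ha, zpow_smul_eq_zpow_smul (hg.smul_eq_op_smul a), MulOpposite.op_zpow]
    _ = comp a.1 (g y ^ (q * c) • b).1 := (comp_assoc _ _ _).symm
    _ = comp a.1 b.1 := by rw [hb]

theorem RectAtom.exists_zpow_smul_le_comp (hg : IsCoherent A g) {w w' : MAtom A}
    {a : RectAtom x w} {b : RectAtom w y} {a' : RectAtom x w'} {b' : RectAtom w' y}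
    {e : RectAtom w w'} (ha : a'.1 ≤ comp a.1 e.1) (hb : b.1 ≤ comp e.1 b'.1) {c : RectAtom x y}
    (hc : c.1 ≤ comp a.1 b.1) :
    ∃ k : ℤ, (numAtoms x w : ℤ) ∣ k ∧ (g x ^ (-k) • c).1 ≤ comp a'.1 b'.1 := by
  have hcover : c.1 ≤ comp ident (comp (comp a.1 a.conv.1) (comp a'.1 b'.1)) :=
    calc c.1 ≤ comp a.1 (comp (comp a.conv.1 a'.1) b'.1) :=
          hc.trans (comp_mono_right _ (hb.trans (comp_mono_left _ (le_comp_conv_left ha))))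
      _ = _ := by rw [ident_comp, comp_assoc, comp_assoc, comp_assoc]
  obtain ⟨f, hfa, hf⟩ :=
    AtomGroup.exists_le_comp_comp (comp_le_rect a.2.2 a.conv.2.2) c.2.1 hcover
  obtain ⟨k, rfl⟩ := hg.mem_zpowers x f
  refine ⟨k, (zpow_smul_eq_self_iff (hg.mem_zpowers x) a).mp ((smul_eq_self_iff _ a).mpr hfa), ?_⟩
  rw [ident_comp] at hf
  rw [zpow_neg]
  exact (comp_mono_right _ hf).trans
    (AtomGroup.conv_comp_comp _ (comp_le_rect a'.2.2 b'.2.2)).le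

theorem exists_forall_le_comp [Finite (AtomGroup x)] (hg : IsCoherent A g) (hxy : Linked x y)
    {ι : Type*} {w : ι → MAtom A} (a : ∀ i, RectAtom x (w i)) (b : ∀ i, RectAtom (w i) y)
    (htri : ∀ i j, ∃ e : RectAtom (w i) (w j),
      (a j).1 ≤ comp (a i).1 e.1 ∧ (b i).1 ≤ comp e.1 (b j).1) :
    ∃ c : RectAtom x y, ∀ i, c.1 ≤ comp (a i).1 (b i).1 := by
  obtain ⟨c₀⟩ := hxy
  have hexp (i) : ∃ r : ℤ, (g x ^ r • c₀).1 ≤ comp (a i).1 (b i).1 := by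
    obtain ⟨c, hc⟩ := RectAtom.exists_le_comp (a i) (b i)
    obtain ⟨f, rfl⟩ := MulAction.exists_smul_eq (AtomGroup x) c₀ c
    obtain ⟨r, rfl⟩ := hg.mem_zpowers x f
    exact ⟨r, hc⟩
  choose r hr using hexp
  let d (i) : ℕ := Nat.gcd (numAtoms x (w i)) (numAtoms (w i) y)
  have hd (i) : d i ∣ Nat.card (AtomGroup x) :=
    (Nat.gcd_dvd_left _ _).trans (numAtoms_dvd_card (a i))
  have hcompat (i j) : ((Nat.gcd (d i) (d j) : ℕ) : ℤ) ∣ r i - r j := by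
    obtain ⟨e, ha, hb⟩ := htri i j
    obtain ⟨k, hk, hle⟩ := RectAtom.exists_zpow_smul_le_comp hg ha hb (hr i)
    have hj : (d j : ℤ) ∣ r i - r j - k := by
      refine RectAtom.gcd_dvd_of_le_comp (hg.mem_zpowers x) (hg.mem_zpowers (w j)) (hr j) ?_
      rwa [← mul_smul, ← zpow_add, show -k + r i = r i - r j - k + r j by ring, zpow_add,
        mul_smul] at hle
    have hi : (d i : ℤ) ∣ k := (Int.natCast_dvd_natCast.mpr (Nat.gcd_dvd_left _ _)).trans hk
    exact (dvd_sub_left ((Int.natCast_dvd_natCast.mpr (Nat.gcd_dvd_left _ _)).trans hi)).mp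
      ((Int.natCast_dvd_natCast.mpr (Nat.gcd_dvd_right _ _)).trans hj)
  obtain ⟨k, hk, -⟩ := exists_simultaneous_residue Nat.card_pos.ne' hd hcompat
  refine ⟨g x ^ k • c₀, fun i => ?_⟩
  calc (g x ^ k • c₀).1 = (g x ^ (k - r i) • g x ^ r i • c₀).1 := by
        rw [← mul_smul, ← zpow_add, sub_add_cancel]
    _ ≤ comp (g x ^ (k - r i)).1 (comp (a i).1 (b i).1) := comp_mono_right _ (hr i)
    _ = comp (a i).1 (b i).1 := hg.zpow_comp_comp_eq (a i) (b i) (hk i)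

section Columns

/-- A choice of an atom in each nonempty rectangle with left side `x`. -/
abbrev Column (x : MAtom A) : Type u := ∀ y : MAtom A, Linked x y → RectAtom x y

/-- Consistency of the triangles that two columns, at `y` and at `x`, form over each `z` preceding
`x`. -/
def Column.Consistent (r : MAtom A → MAtom A → Prop) (a : Column y) (b : Column x) : Prop :=
  ∀ z, r z x → ∀ (hyx : Linked y x) (hxz : Linked x z) (hyz : Linked y z),
    (a z hyz).1 ≤ comp (a x hyx).1 (b z hxz).1

variable [∀ x : MAtom A, Finite (AtomGroup x)] {r : MAtom A → MAtom A → Prop}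

theorem Column.exists_entry [Std.Trichotomous r] (hg : IsCoherent A g) (hyx : Linked y x)
    {a : Column y} {b : Column x} {c : ∀ z, Column z} (ha : ∀ z, r z x → a.Consistent r (c z))
    (hb : ∀ z, r z x → b.Consistent r (c z)) :
    ∃ p : RectAtom y x, ∀ z, r z x → ∀ (hxz : Linked x z) (hyz : Linked y z),
      (a z hyz).1 ≤ comp p.1 (b z hxz).1 := by
  let T (i j : {z // r z x ∧ Linked x z}) : Prop := ∃ e : RectAtom i.1 j.1,
    (a j (hyx.trans j.2.2)).1 ≤ comp (a i (hyx.trans i.2.2)).1 e.1 ∧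
      (b i i.2.2).conv.1 ≤ comp e.1 (b j j.2.2).conv.1
  have T_symm {i j} : T i j → T j i := fun ⟨e, he, he'⟩ =>
    ⟨e.conv, RectAtom.le_comp_conv_right he, RectAtom.le_comp_conv_left he'⟩
  have T_of_rel {i j} (hji : r j.1 i.1) : T i j := by
    have hij : Linked i.1 j.1 := i.2.2.symm.trans j.2.2
    have htri := hb i i.2.1 j hji i.2.2 hij j.2.2
    exact ⟨c i j hij, ha i i.2.1 j hji _ hij _,
      RectAtom.le_comp_conv_right (RectAtom.le_comp_conv_left htri)⟩
  have hT (i j) : T i j := by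
    rcases trichotomous_of r j.1 i.1 with h | h | h
    · exact T_of_rel h
    · obtain rfl := Subtype.ext h
      exact ⟨.refl j.1, (comp_eq_of_le_rect_right y.2.le_ident j.1.2.le_ident (a j _).2.2).ge,
        (comp_eq_of_le_rect_left j.1.2.le_ident (b j _).conv.2.2).ge⟩
    · exact T_symm (T_of_rel h)
  obtain ⟨p, hp⟩ := exists_forall_le_comp hg hyx _ _ hT
  refine ⟨p, fun z hz hxz _ => ?_⟩
  simpa only [RectAtom.conv_conv] using RectAtom.le_comp_conv_right (hp ⟨z, hz, hxz⟩)

theorem Column.exists_consistent [IsWellOrder (MAtom A) r] (hg : IsCoherent A g) (y : MAtom A)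
    (c : ∀ x, Column x) (hc : ∀ x z, r x y → r z x → (c x).Consistent r (c z)) :
    ∃ a : Column y, ∀ x, r x y → a.Consistent r (c x) := by
  have hne (x : MAtom A) : Nonempty (Linked y x → RectAtom y x) := ⟨fun h => h.some⟩
  let P {x z : MAtom A} (p : Linked y x → RectAtom y x) (q : Linked y z → RectAtom y z) : Prop :=
    r x y → ∀ (hyx : Linked y x) (hxz : Linked x z) (hyz : Linked y z),
      (q hyz).1 ≤ comp (p hyx).1 (c x z hxz).1
  have step (x : MAtom A) (a : Column y) (ha : ∀ z w, r z x → r w z → P (a z) (a w)) :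
      ∃ p : Linked y x → RectAtom y x, ∀ z, r z x → P p (a z) := by
    by_cases hxy : r x y
    · choose p hp using fun hyx => exists_entry hg hyx
        (fun z hz w hw => ha z w hz hw (_root_.trans hz hxy)) (hc x · hxy)
      exact ⟨p, fun z hz _ hyx => hp hyx z hz⟩
    · exact ⟨fun h => h.some, fun _ _ h => absurd h hxy⟩
  obtain ⟨a, ha⟩ := exists_forall_rel_of_wellFounded (β := fun x => Linked y x → RectAtom y x)
    (P := P) (IsWellFounded.wf (r := r)) step
  exact ⟨a, fun x hx z hz => ha x z hz hx⟩

theorem Column.exists_forall_consistent [IsWellOrder (MAtom A) r] (hg : IsCoherent A g) :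
    ∃ c : ∀ x : MAtom A, Column x, ∀ y x, r x y → (c y).Consistent r (c x) := by
  have hne (x : MAtom A) : Nonempty (Column x) := ⟨fun _ h => h.some⟩
  exact exists_forall_rel_of_wellFounded (P := Column.Consistent r) (IsWellFounded.wf (r := r))
    (Column.exists_consistent hg)

end Columns

variable (A) in
/-- A consistent network of atoms, one in each nonempty rectangle. -/
structure Scaffold where
  edge : ∀ {x y : MAtom A}, Linked x y → RectAtom x y
  edge_self : ∀ {x : MAtom A} (h : Linked x x), edge h = .refl x
  conv_edge : ∀ {x y : MAtom A} (h : Linked x y), (edge h).conv = edge h.symm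
  edge_le_comp : ∀ {x y z : MAtom A} (hxy : Linked x y) (hyz : Linked y z) (hxz : Linked x z),
    (edge hxz).1 ≤ comp (edge hxy).1 (edge hyz).1

theorem exists_edge_of_columns {r : MAtom A → MAtom A → Prop} [IsStrictTotalOrder (MAtom A) r]
    (c : ∀ x : MAtom A, Column x) :
    ∃ e : ∀ x : MAtom A, Column x, (∀ x y h, r y x → e x y h = c x y h) ∧
      (∀ x h, e x x h = .refl x) ∧ ∀ x y h, (e x y h).conv = e y x h.symm := by
  classical
  let e (x y : MAtom A) (h : Linked x y) : RectAtom x y :=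
    if r y x then c x y h else if hxy : x = y then hxy ▸ .refl x else (c y x h.symm).conv
  have e_of_rel {x y : MAtom A} (h : Linked x y) (hyx : r y x) : e x y h = c x y h := if_pos hyx
  have e_self (x : MAtom A) (h : Linked x x) : e x x h = .refl x :=
    (if_neg (irrefl_of r x)).trans (dif_pos rfl)
  have e_swap {x y : MAtom A} (h : Linked x y) (hxy : r x y) : e x y h = (c y x h.symm).conv :=
    (if_neg (asymm_of r hxy)).trans (dif_neg (ne_of_irrefl hxy))
  refine ⟨e, fun x y => e_of_rel, e_self, fun x y h => ?_⟩
  rcases trichotomous_of r x y with hxy | rfl | hyx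
  · rw [e_swap h hxy, e_of_rel h.symm hxy, RectAtom.conv_conv]
  · rw [e_self]
    exact Subtype.ext (conv_eq_self x.2.le_ident)
  · rw [e_of_rel h hyx, e_swap h.symm hyx]

theorem IsCoherent.nonempty_scaffold [∀ x : MAtom A, Finite (AtomGroup x)] (hg : IsCoherent A g) :
    Nonempty (Scaffold A) := by
  let r : MAtom A → MAtom A → Prop := WellOrderingRel
  obtain ⟨c, hc⟩ := Column.exists_forall_consistent (r := r) hg
  obtain ⟨e, he, e_self, e_conv⟩ := exists_edge_of_columns (r := r) c
  let T (x y z : MAtom A) : Prop := ∀ (hxy : Linked x y) (hyz : Linked y z) (hxz : Linked x z),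
    (e x z hxz).1 ≤ comp (e x y hxy).1 (e y z hyz).1
  have reverse {x y z} (h : T x y z) : T z y x := fun hzy hyx hzx => by
    simpa only [e_conv] using RectAtom.conv_le_comp (h hyx.symm hzy.symm hzx.symm)
  have swap {x y z} (h : T x y z) : T y x z := fun hyx hxz hyz => by
    simpa only [e_conv] using RectAtom.le_comp_conv_left (h hyx.symm hyz hxz)
  have diag (x z) : T x x z := fun hxx hxz _ => by
    rw [e_self]
    exact (comp_eq_of_le_rect_left x.2.le_ident (e x z hxz).2.2).ge
  have ordered {x y z} (hxy : r x y) (hyz : r y z) : T x y z := reverse fun hzy hyx hzx => by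
    rw [he z x hzx (_root_.trans hxy hyz), he z y hzy hyz, he y x hyx hxy]
    exact hc z y hyz x hxy hzy hyx hzx
  exact ⟨⟨e _ _, e_self _, e_conv _ _,
    fun {x y z} => forall_of_trichotomous (T := T) r swap reverse diag ordered x y z⟩⟩

end Scaffolds

section Embeddings

variable {A : Type u} [RelationAlgebra A] {U : Type u} {D : SetRelationAlgebra U} {e : A → D.Elem}

theorem isIsomorphism_id : IsIsomorphism (id : A → A) where
  injective := Function.injective_id
  map_sup _ _ := rfl
  map_compl _ := rfl
  map_comp _ _ := rfl
  map_conv _ := rfl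
  map_ident := rfl
  surjective := Function.surjective_id

theorem IsEmbedding.map_top (he : IsEmbedding e) : e ⊤ = ⊤ := by
  rw [← sup_compl_eq_top (x := (⊤ : A)), he.map_sup, he.map_compl, sup_compl_eq_top]

/-- The image of an embedding into a set relation algebra, as a set relation algebra. -/
def IsEmbedding.range (he : IsEmbedding e) : SetRelationAlgebra U where
  carrier := Set.range fun a => (e a).1
  unit := D.unit
  unit_mem := ⟨⊤, congrArg Subtype.val he.map_top⟩
  subset_unit := by
    rintro _ ⟨a, rfl⟩
    exact D.subset_unit _ (e a).2
  union_mem := by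
    rintro _ ⟨a, rfl⟩ _ ⟨b, rfl⟩
    exact ⟨a ⊔ b, congrArg Subtype.val (he.map_sup a b)⟩
  compl_mem := by
    rintro _ ⟨a, rfl⟩
    exact ⟨aᶜ, congrArg Subtype.val (he.map_compl a)⟩
  comp_mem := by
    rintro _ ⟨a, rfl⟩ _ ⟨b, rfl⟩
    exact ⟨comp a b, congrArg Subtype.val (he.map_comp a b)⟩
  inv_mem := by
    rintro _ ⟨a, rfl⟩
    exact ⟨conv a, congrArg Subtype.val (he.map_conv a)⟩
  id_mem := ⟨ident, congrArg Subtype.val he.map_ident⟩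

theorem IsEmbedding.completelyRepresentable (he : IsEmbedding e)
    (hsup : ∀ (X : Set A) (a : A), IsLUB X a → (e a).1 = ⋃ x ∈ X, (e x).1) :
    CompletelyRepresentable A :=
  ⟨U, he.range, fun a => ⟨(e a).1, a, rfl⟩,
    { injective := fun _ _ h => he.injective (Subtype.ext (Subtype.mk.inj h))
      map_sup := fun a b => Subtype.ext (congrArg Subtype.val (he.map_sup a b) :)
      map_compl := fun a => Subtype.ext (congrArg Subtype.val (he.map_compl a) :)
      map_comp := fun a b => Subtype.ext (congrArg Subtype.val (he.map_comp a b) :)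
      map_conv := fun a => Subtype.ext (congrArg Subtype.val (he.map_conv a) :)
      map_ident := Subtype.ext (congrArg Subtype.val he.map_ident :)
      surjective := fun ⟨_, a, ha⟩ => ⟨a, Subtype.ext ha⟩ }, hsup⟩

end Embeddings

/-! ### Atoms of a measurable relation algebra -/

section Representation

variable {A : Type u} [RelationAlgebra A] {x y z x' y' : MAtom A}

theorem IsMeasurable.exists_comp_ne_bot (hA : IsMeasurable A) {a : A} (ha : a ≠ ⊥) :
    ∃ x : MAtom A, comp a x.1 ≠ ⊥ := by
  by_contra! h
  have hident : (ident : A) ≤ (comp (conv a) ⊤)ᶜ := hA.2 fun x hx => by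
    rw [le_compl_iff_disjoint_right, ← disjoint_comp_left, disjoint_top]
    exact h ⟨x, hx⟩
  rw [le_compl_iff_disjoint_right, ← disjoint_comp_left, comp_ident, disjoint_top] at hident
  exact ha hident

namespace RectAtom

theorem exists_le_of_ne_bot [∀ x : MAtom A, Finite (AtomGroup x)] (hA : IsMeasurable A) {a : A}
    (ha : a ≠ ⊥) : ∃ (x y : MAtom A) (b : RectAtom x y), b.1 ≤ a := by
  obtain ⟨y, hy⟩ := hA.exists_comp_ne_bot ha
  obtain ⟨x, hx⟩ := hA.exists_comp_ne_bot (conv_eq_bot.not.mpr hy)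
  have hxy : comp x.1 (comp a y.1) ≠ ⊥ := by
    rwa [← conv_eq_bot.ne, conv_comp, conv_eq_self x.2.le_ident]
  obtain ⟨b, hb⟩ := exists_le (le_rect_of_comp_eq (by rw [comp_assoc, comp_self x.2.le_ident])
    (by rw [← comp_assoc, ← comp_assoc, comp_self y.2.le_ident])) hxy
  refine ⟨x, y, b, hb.trans ?_⟩
  calc comp x.1 (comp a y.1) ≤ comp ident (comp a ident) :=
        comp_mono x.2.le_ident (comp_mono_right a y.2.le_ident)
    _ = a := by rw [comp_ident, ident_comp]

theorem left_unique {a : RectAtom x y} {a' : RectAtom x' y'} (h : a.1 = a'.1) : x = x' := by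
  have hne : comp x.1 x'.1 ≠ ⊥ := fun h₀ => a.2.1.1 <| by
    rw [← comp_eq_of_le_rect_left x.2.le_ident a.2.2, h,
      ← comp_eq_of_le_rect_left x'.2.le_ident a'.2.2, comp_assoc, h₀, bot_comp]
  have hx : comp x.1 x'.1 = x.1 := (x.2.isAtom.le_iff_eq hne).mp <|
    (comp_mono_right _ x'.2.le_ident).trans (comp_ident _).le
  have hx' : comp x.1 x'.1 = x'.1 := (x'.2.isAtom.le_iff_eq hne).mp <|
    (comp_mono_left _ x.2.le_ident).trans (ident_comp _).le
  exact Subtype.ext (hx.symm.trans hx')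

theorem right_unique {a : RectAtom x y} {a' : RectAtom x' y'} (h : a.1 = a'.1) : y = y' :=
  left_unique (a := a.conv) (a' := a'.conv) (congrArg RelationAlgebra.conv h)

theorem le_ident_iff {a : RectAtom x y} : a.1 ≤ ident ↔ a.1 = x.1 := by
  refine ⟨fun h => (x.2.isAtom.le_iff_eq a.2.1.1).mp ?_, fun h => h.trans_le x.2.le_ident⟩
  rw [← comp_eq_of_le_rect_left x.2.le_ident a.2.2]
  exact (comp_mono_right _ h).trans (comp_ident _).le

theorem exists_le_comp_of_le_comp [∀ x : MAtom A, Finite (AtomGroup x)] (hA : IsMeasurable A)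
    {s t : A} (c : RectAtom x z) (h : c.1 ≤ comp s t) :
    ∃ (y : MAtom A) (a : RectAtom x y) (b : RectAtom y z),
      a.1 ≤ s ∧ b.1 ≤ t ∧ c.1 ≤ comp a.1 b.1 := by
  have hs : s ⊓ comp c.1 (RelationAlgebra.conv t) ≠ ⊥ := by
    rwa [Ne, ← disjoint_iff, ← disjoint_comp_right, disjoint_comm, c.2.1.not_disjoint_iff_le]
  obtain ⟨y, hy⟩ := hA.exists_comp_ne_bot hs
  have hrect : comp (s ⊓ comp c.1 (RelationAlgebra.conv t)) y.1 ≤ rect x.1 y.1 := by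
    refine comp_mono_left y.1 (inf_le_right.trans ?_)
    rw [← comp_eq_of_le_rect_left x.2.le_ident c.2.2, ← comp_assoc]
    exact comp_mono_right _ le_top
  obtain ⟨a, ha⟩ := exists_le hrect hy
  have ha' := ha.trans ((comp_mono_right _ y.2.le_ident).trans (comp_ident _).le)
  have ht : t ⊓ comp a.conv.1 c.1 ≠ ⊥ := by
    rw [Ne, ← disjoint_iff, conv, ← disjoint_comp_left, disjoint_comp_right,
      a.2.1.not_disjoint_iff_le]
    exact ha'.trans inf_le_right
  obtain ⟨b, hb⟩ := exists_le (inf_le_right.trans (comp_le_rect a.conv.2.2 c.2.2)) ht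
  refine ⟨y, a, b, ha'.trans inf_le_left, hb.trans inf_le_left, ?_⟩
  simpa only [conv_conv] using le_comp_conv_left (hb.trans inf_le_right)

end RectAtom

variable (A) in
/-- The index system with the numbers of atoms `m_xy`, where `n_x = m_xx` is the order of `G_x`. -/
noncomputable def indexSystem [∀ x : MAtom A, Finite (AtomGroup x)]
    [∀ x : MAtom A, IsCyclic (AtomGroup x)] : IndexSystem (MAtom A) where
  E := ⟨Linked, Linked.refl, Linked.symm, Linked.trans⟩
  n x := numAtoms x x
  n_pos x := numAtoms_self x ▸ Nat.card_pos
  m := numAtoms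
  m_pos x _ h := Nat.pos_of_dvd_of_pos (numAtoms_dvd_card h.some) Nat.card_pos
  dvd_left x _ h := numAtoms_self x ▸ numAtoms_dvd_card h.some
  dvd_right x y h := by
    rw [numAtoms_comm, numAtoms_self]
    exact numAtoms_dvd_card h.some.conv
  m_self _ := rfl
  m_symm x y _ := numAtoms_comm y x
  gcd_left x y z hxy hyz := by
    refine Nat.dvd_antisymm
      (Nat.dvd_gcd (Nat.gcd_dvd_left _ _) (RectAtom.gcd_numAtoms_dvd hxy hyz))
      (Nat.dvd_gcd (Nat.gcd_dvd_left _ _) ?_)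
    rw [numAtoms_comm x y]
    exact RectAtom.gcd_numAtoms_dvd hxy.symm (hxy.trans hyz)
  gcd_right x y z hxy hyz := by
    refine Nat.dvd_antisymm (Nat.dvd_gcd (Nat.gcd_dvd_right _ _) ?_)
      (Nat.dvd_gcd ?_ (Nat.gcd_dvd_left _ _))
    · rw [numAtoms_comm x y]
      exact RectAtom.gcd_numAtoms_dvd hxy.symm (hxy.trans hyz)
    · rw [numAtoms_comm y z]
      exact RectAtom.gcd_numAtoms_dvd (hxy.trans hyz) hyz.symm

namespace Scaffold

variable (s : Scaffold A) {g : ∀ x : MAtom A, AtomGroup x} {k l : ℤ}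

variable (g) in
/-- The atom below the rectangle `x;1;y` that corresponds to the relation `R_{xy,α}`, where `α` is
the coset of `k`. -/
def label (h : Linked x y) (k : ℤ) : RectAtom x y := g x ^ k • s.edge h

theorem zpow_smul_label (h : Linked x y) (k l : ℤ) :
    g x ^ k • s.label g h l = s.label g h (k + l) := by
  rw [label, label, zpow_add, mul_smul]

variable (hg : IsCoherent A g)
include hg

theorem label_eq_iff (h : Linked x y) :
    s.label g h k = s.label g h l ↔ (numAtoms x y : ℤ) ∣ k - l := by
  rw [← zpow_smul_eq_self_iff (hg.mem_zpowers x) (s.label g h l), zpow_smul_label,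
    sub_add_cancel]

theorem exists_label_eq (h : Linked x y) (a : RectAtom x y) : ∃ k, s.label g h k = a := by
  obtain ⟨f, hf⟩ := MulAction.exists_smul_eq (AtomGroup x) (s.edge h) a
  obtain ⟨k, rfl⟩ := hg.mem_zpowers x f
  exact ⟨k, hf⟩

theorem label_eq_op_zpow_smul (h : Linked x y) (k : ℤ) :
    s.label g h k = s.edge h <• g y ^ k := by
  rw [label, zpow_smul_eq_zpow_smul (hg.smul_eq_op_smul _), MulOpposite.op_zpow]

theorem conv_label (h : Linked x y) (k : ℤ) :
    (s.label g h k).conv = s.label g h.symm (-k) := by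
  rw [label, RectAtom.conv_smul, s.conv_edge, label_eq_op_zpow_smul s hg, zpow_neg]

theorem label_add_le_comp (hxy : Linked x y) (hyz : Linked y z) (hxz : Linked x z) (k l : ℤ) :
    (s.label g hxz (k + l)).1 ≤ comp (s.label g hxy k).1 (s.label g hyz l).1 :=
  calc (s.label g hxz (k + l)).1 = comp (g x ^ k).1 (s.label g hxz l).1 := by
        rw [← zpow_smul_label, RectAtom.coe_smul]
    _ = comp (g x ^ k).1 (comp (s.edge hxz).1 (g z ^ l).1) := by
        rw [label_eq_op_zpow_smul s hg, RectAtom.coe_op_smul]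
    _ ≤ comp (g x ^ k).1 (comp (comp (s.edge hxy).1 (s.edge hyz).1) (g z ^ l).1) :=
        comp_mono_right _ (comp_mono_left _ (s.edge_le_comp hxy hyz hxz))
    _ = comp (s.label g hxy k).1 (s.label g hyz l).1 := by
        rw [label_eq_op_zpow_smul s hg hyz, label, RectAtom.coe_smul, RectAtom.coe_op_smul]
        simp only [comp_assoc]

theorem label_le_ident_iff (h : Linked x y) (k : ℤ) :
    (s.label g h k).1 ≤ ident ↔ x = y ∧ (numAtoms x y : ℤ) ∣ k := by
  have label_eq (h : Linked x x) :
      (s.label g h k).1 = x.1 ↔ (numAtoms x x : ℤ) ∣ k := by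
    rw [← zpow_smul_eq_self_iff (hg.mem_zpowers x) (.refl x), ← s.edge_self h, ← label]
    exact ⟨fun hk => Subtype.ext (hk.trans (congrArg Subtype.val (s.edge_self h).symm)),
      fun hk => congrArg Subtype.val (hk.trans (s.edge_self h))⟩
  rw [RectAtom.le_ident_iff]
  constructor
  · intro hx
    obtain rfl : x = y := (RectAtom.right_unique (a' := .refl x) hx).symm
    exact ⟨rfl, (label_eq h).mp hx⟩
  · rintro ⟨rfl, hk⟩
    exact (label_eq h).mpr hk

theorem exists_label_le_of_le_comp [∀ x : MAtom A, Finite (AtomGroup x)] (hA : IsMeasurable A)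
    {r t : A} (hxz : Linked x z) (hk : (s.label g hxz k).1 ≤ comp r t) :
    ∃ (y : MAtom A) (hxy : Linked x y) (hyz : Linked y z) (l : ℤ),
      (s.label g hxy l).1 ≤ r ∧ (s.label g hyz (k - l)).1 ≤ t := by
  obtain ⟨y, a, b, ha, hb, hab⟩ := RectAtom.exists_le_comp_of_le_comp hA _ hk
  have hxy : Linked x y := ⟨a⟩
  have hyz : Linked y z := ⟨b⟩
  obtain ⟨i, rfl⟩ := s.exists_label_eq hg hxy a
  obtain ⟨j, rfl⟩ := s.exists_label_eq hg hyz b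
  have hgcd := RectAtom.gcd_dvd_of_le_comp (hg.mem_zpowers x) (hg.mem_zpowers y)
    (s.label_add_le_comp hg hxy hyz hxz i j) (k := k - (i + j)) (by
      rwa [zpow_smul_label, sub_add_cancel])
  rw [← sub_sub, sub_right_comm] at hgcd
  obtain ⟨l, hl, hl'⟩ := IndexSystem.exists_solution _ _ _ _ hgcd
  refine ⟨y, hxy, hyz, l, ?_, ?_⟩
  · rwa [(s.label_eq_iff hg hxy).mpr hl]
  · rwa [(s.label_eq_iff hg hyz).mpr]
    rwa [sub_right_comm, ← dvd_neg, neg_sub]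

/-! ### The representation -/

variable [∀ x : MAtom A, Finite (AtomGroup x)] [∀ x : MAtom A, IsCyclic (AtomGroup x)]

omit hg in
variable (g) in
/-- The relation representing `r`: the union of the relations that correspond to the atoms of
rectangles below `r`. -/
def relation (r : A) : SetRel (indexSystem A).Base (indexSystem A).Base :=
  {p | ∃ (h : Linked p.1.1 p.2.1) (i j : ℤ),
    (i : (indexSystem A).G p.1.1) = p.1.2 ∧ (j : (indexSystem A).G p.2.1) = p.2.2 ∧
      (s.label g h (j - i)).1 ≤ r}

theorem mem_relation {r : A} {i j : ℤ} :
    ((indexSystem A).point x i, (indexSystem A).point y j) ∈ s.relation g r ↔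
      ∃ h : Linked x y, (s.label g h (j - i)).1 ≤ r := by
  refine ⟨?_, fun ⟨h, hr⟩ => ⟨h, i, j, rfl, rfl, hr⟩⟩
  rintro ⟨h, i', j', hi, hj, hr⟩
  have hi' : (numAtoms x y : ℤ) ∣ i - i' :=
    (Int.natCast_dvd_natCast.mpr ((indexSystem A).dvd_left x y h)).trans
      ((ZMod.intCast_eq_intCast_iff_dvd_sub _ _ _).mp hi)
  have hj' : (numAtoms x y : ℤ) ∣ j - j' :=
    (Int.natCast_dvd_natCast.mpr ((indexSystem A).dvd_right x y h)).trans
      ((ZMod.intCast_eq_intCast_iff_dvd_sub _ _ _).mp hj)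
  refine ⟨h, ?_⟩
  rwa [(s.label_eq_iff hg h).mpr]
  rw [sub_sub_sub_comm]
  exact dvd_sub hj' hi'

theorem relation_mem_carrier (r : A) : s.relation g r ∈ (indexSystem A).algebra.carrier := by
  refine ((indexSystem A).mem_carrier_iff _).mpr fun x y i j hij => ?_
  obtain ⟨h, hr⟩ := (s.mem_relation hg).mp hij
  refine ⟨h, fun i' j' hd => (s.mem_relation hg).mpr ⟨h, ?_⟩⟩
  rwa [(s.label_eq_iff hg h).mpr hd]

theorem relation_eq_iUnion {X : Set A} {a : A} (ha : IsLUB X a) :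
    s.relation g a = ⋃ r ∈ X, s.relation g r := by
  refine IndexSystem.rel_ext fun x y i j => ?_
  rw [Set.mem_iUnion₂, s.mem_relation hg]
  constructor
  · rintro ⟨h, hle⟩
    by_contra! hX
    have hcompl : a ≤ (s.label g h (j - i)).1ᶜ := ha.2 fun r hr => by
      rw [le_compl_iff_disjoint_left]
      exact not_not.mp fun hd =>
        hX r hr ((s.mem_relation hg).mpr ⟨h, (s.label g h _).2.1.not_disjoint_iff_le.mp hd⟩)
    exact (s.label g h _).2.1.1 (disjoint_self.mp (le_compl_iff_disjoint_right.mp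
      (hle.trans hcompl)))
  · rintro ⟨r, hr, hp⟩
    obtain ⟨h, hle⟩ := (s.mem_relation hg).mp hp
    exact ⟨h, hle.trans (ha.1 hr)⟩

theorem relation_sup (r t : A) : s.relation g (r ⊔ t) = s.relation g r ∪ s.relation g t := by
  rw [s.relation_eq_iUnion hg isLUB_pair, Set.biUnion_pair]

theorem relation_compl (r : A) :
    s.relation g rᶜ = (indexSystem A).algebra.unit \ s.relation g r := by
  refine IndexSystem.rel_ext fun x y i j => ?_
  rw [s.mem_relation hg, Set.mem_sdiff, s.mem_relation hg]
  change _ ↔ Linked x y ∧ _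
  rw [← exists_prop]
  refine exists_congr fun h => ?_
  rw [exists_prop_of_true h, ← (s.label g h _).2.1.not_disjoint_iff_le, disjoint_compl_right_iff]

theorem relation_comp (hA : IsMeasurable A) (r t : A) :
    s.relation g (comp r t) = (s.relation g r).comp (s.relation g t) := by
  refine IndexSystem.rel_ext fun x z i k => ?_
  rw [s.mem_relation hg]
  constructor
  · rintro ⟨hxz, hle⟩
    obtain ⟨y, hxy, hyz, l, hr, ht⟩ := s.exists_label_le_of_le_comp hg hA hxz hle
    refine ⟨(indexSystem A).point y (i + l), (s.mem_relation hg).mpr ⟨hxy, ?_⟩,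
      (s.mem_relation hg).mpr ⟨hyz, ?_⟩⟩
    · rwa [add_sub_cancel_left]
    · rwa [← sub_sub]
  · rintro ⟨q, hr, ht⟩
    obtain ⟨y, j, rfl⟩ := IndexSystem.exists_eq_point q
    obtain ⟨hxy, hr⟩ := (s.mem_relation hg).mp hr
    obtain ⟨hyz, ht⟩ := (s.mem_relation hg).mp ht
    have hadd := s.label_add_le_comp hg hxy hyz (hxy.trans hyz) (j - i) (k - j)
    rw [add_comm, sub_add_sub_cancel] at hadd
    exact ⟨hxy.trans hyz, hadd.trans (comp_mono hr ht)⟩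

theorem relation_conv (r : A) : s.relation g (conv r) = (s.relation g r).inv := by
  refine IndexSystem.rel_ext fun x y i j => ?_
  have conv_iff (h : Linked x y) :
      (s.label g h (j - i)).1 ≤ conv r ↔ (s.label g h.symm (i - j)).1 ≤ r := by
    rw [← neg_sub j i, ← s.conv_label hg, RectAtom.conv, conv_le_comm]
  rw [SetRel.mem_inv, s.mem_relation hg, s.mem_relation hg]
  exact ⟨fun ⟨h, hr⟩ => ⟨h.symm, (conv_iff h).mp hr⟩,
    fun ⟨h, hr⟩ => ⟨h.symm, (conv_iff h.symm).mpr hr⟩⟩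

theorem relation_ident : s.relation g ident = SetRel.id := by
  refine IndexSystem.rel_ext fun x y i j => ?_
  rw [s.mem_relation hg, SetRel.mem_id, IndexSystem.point_eq_point_iff]
  refine ⟨fun ⟨h, hle⟩ => (s.label_le_ident_iff hg h _).mp hle, fun hxy => ?_⟩
  have h : Linked x y := hxy.1 ▸ .refl x
  exact ⟨h, (s.label_le_ident_iff hg h _).mpr hxy⟩

theorem le_of_relation_subset (hA : IsMeasurable A) {r t : A}
    (h : s.relation g r ⊆ s.relation g t) : r ≤ t := by
  by_contra hrt
  obtain ⟨x, y, a, ha⟩ := RectAtom.exists_le_of_ne_bot hA (sdiff_eq_bot_iff.not.mpr hrt)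
  obtain ⟨k, hk⟩ := s.exists_label_eq hg ⟨a⟩ a
  rw [← hk, ← sub_zero k] at ha
  obtain ⟨h', ht⟩ :=
    (s.mem_relation hg).mp (h ((s.mem_relation hg).mpr ⟨⟨a⟩, ha.trans sdiff_le⟩))
  exact (s.label g h' _).2.1.1 (disjoint_self.mp (disjoint_sdiff_self_left.mono ha ht))

theorem relation_injective (hA : IsMeasurable A) : Function.Injective (s.relation g) :=
  fun _ _ h => (s.le_of_relation_subset hg hA h.subset).antisymm
    (s.le_of_relation_subset hg hA h.superset)

omit hg in
/-- The representation `r ↦ s.relation g r`, with values in the cyclic group relation algebra. -/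
def represent (hg : IsCoherent A g) (r : A) : (indexSystem A).algebra.Elem :=
  ⟨s.relation g r, s.relation_mem_carrier hg r⟩

theorem isEmbedding_represent (hA : IsMeasurable A) : IsEmbedding (s.represent hg) where
  injective _ _ h := s.relation_injective hg hA (congrArg Subtype.val h)
  map_sup r t := Subtype.ext (s.relation_sup hg r t)
  map_compl r := Subtype.ext (s.relation_compl hg r)
  map_comp r t := Subtype.ext (s.relation_comp hg hA r t)
  map_conv r := Subtype.ext (s.relation_conv hg r)
  map_ident := Subtype.ext (s.relation_ident hg)

theorem mem_relation_label_iff {h : Linked x y} {i j k : ℤ} :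
    ((indexSystem A).point x' i, (indexSystem A).point y' j) ∈ s.relation g (s.label g h k).1 ↔
      x' = x ∧ y' = y ∧ (numAtoms x y : ℤ) ∣ j - i - k := by
  rw [s.mem_relation hg]
  constructor
  · rintro ⟨h', hle⟩
    have heq := ((s.label g h k).2.1.le_iff_eq (s.label g h' _).2.1.1).mp hle
    obtain rfl := RectAtom.left_unique heq
    obtain rfl := RectAtom.right_unique heq
    exact ⟨rfl, rfl, (s.label_eq_iff hg h).mp (Subtype.ext heq)⟩
  · rintro ⟨rfl, rfl, hd⟩
    exact ⟨h, (congrArg Subtype.val ((s.label_eq_iff hg h).mpr hd)).le⟩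

theorem isCompletion_represent (hA : IsMeasurable A) : IsCompletion (s.represent hg) where
  toIsEmbedding := s.isEmbedding_represent hg hA
  complete := IndexSystem.exists_isLUB
  dense T := by
    refine ⟨fun _ h => h.2, fun V hV => IndexSystem.rel_subset_iff.mpr fun x y i j hp => ?_⟩
    obtain ⟨h, hT⟩ := ((indexSystem A).mem_carrier_iff T.1).mp T.2 x y i j hp
    have hle : s.relation g (s.label g h (j - i)).1 ⊆ T.1 := by
      refine IndexSystem.rel_subset_iff.mpr fun x' y' i' j' hq => ?_
      obtain ⟨rfl, rfl, hd⟩ := (s.mem_relation_label_iff hg).mp hq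
      exact hT i' j' hd
    have hmem : s.represent hg (s.label g h (j - i)).1 ≤ V := hV ⟨⟨_, rfl⟩, hle⟩
    exact hmem ((s.mem_relation_label_iff hg).mpr ⟨rfl, rfl, by simp⟩)

end Scaffold
end Representation

end RelationAlgebra
end RelAlg

theorem mainTheorem1 {A : Type u} [RelAlg.RelationAlgebra A]
    (hA : RelAlg.RelationAlgebra.IsMeasurable A)
    (hG : ∀ x : {x : A // RelAlg.RelationAlgebra.IsMeasurableAtom x},
      Finite (RelAlg.RelationAlgebra.AtomGroup x) ∧
        IsCyclic (RelAlg.RelationAlgebra.AtomGroup x)) :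
    (∃ (I : Type u) (D : RelAlg.IndexSystem I),
      RelAlg.RelationAlgebra.EssentiallyIsomorphic A D.algebra.Elem) ∧
    RelAlg.CompletelyRepresentable A := by
  have hfinite := fun x => (hG x).1
  have hcyclic := fun x => (hG x).2
  obtain ⟨g, hg⟩ := RelAlg.RelationAlgebra.exists_isCoherent A
  obtain ⟨s⟩ := hg.nonempty_scaffold
  have hcompletion := s.isCompletion_represent hg hA
  refine ⟨⟨_, RelAlg.RelationAlgebra.indexSystem A, _, inferInstance, ⟨_, hcompletion⟩, id,
    RelAlg.RelationAlgebra.isIsomorphism_id⟩, ?_⟩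
  exact hcompletion.toIsEmbedding.completelyRepresentable fun _ _ h => s.relation_eq_iUnion hg h
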